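/- Let $d\ge 1$, let $\nu\in\mathbb{R}^d$ and let $\Sigma$ be a symmetric positive definite real $d\times d$ matrix. Let $X_1,X_2,\dots$ be i.i.d. random vectors with the Gaussian law $N(\nu,\Sigma)$ on $\mathbb{R}^d$, and let $f$ be the density of this law. For $N\ge 2$ let $\rho_i:=\min\{\|X_i-X_j\| : 1\le j\le N,\ j\ne i\}$ (Euclidean norm), $i=1,\dots,N$, let $\overline{\rho}_N:=(\rho_1\cdots\rho_N)^{1/N}$, and let $$H_N:=d\log\overline{\rho}_N+\log V_d+\gamma+\log(N-1)$$ be the Kozachenko–Leonenko estimate, where $V_d=\pi^{d/2}/\Gamma(\frac d2+1)$ is the volume of the unit ball of $\mathbb{R}^d$ and $\gamma$ is the Euler–Mascheroni constant. Put $H:=\frac12\log\det(2\pi e\Sigma)$. Then $f\log f$ is integrable and $H=-\int_{\mathbb{R}^d} f(x)\log f(x)\,dx$ is the Shannon differential entropy of $f$; moreover $\mathsf{E}H_N^2<\infty$ for every $N\ge2$, and the estimates $H_N$ are asymptotically unbiased and $L^2$-consistent: $$\lim_{N\to\infty}\mathsf{E}H_N=H,\qquad \lim_{N\to\infty}\mathsf{E}(H_N-H)^2=0.$$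 -/

import Mathlib

open MeasureTheory ProbabilityTheory Filter Topology

noncomputable section

/-- The distance from the `i`-th point of a sample `x` to its nearest neighbour among
the other points: `min {‖x i - x j‖ : j ≠ i}` (a minimum over a nonempty finite set once the
sample has at least two points). -/
def nearestNeighborDist {d N : ℕ} (x : Fin N → EuclideanSpace ℝ (Fin d)) (i : Fin N) : ℝ :=
  ⨅ j : {j : Fin N // j ≠ i}, dist (x i) (x j)

/-- The geometric mean of the nearest neighbour distances of a sample. -/
def meanNearestNeighborDist {d N : ℕ} (x : Fin N → EuclideanSpace ℝ (Fin d)) : ℝ :=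
  (∏ i : Fin N, nearestNeighborDist x i) ^ ((1 : ℝ) / N)

/-- The volume `π ^ (d / 2) / Γ (d / 2 + 1)` of the unit ball of the Euclidean space `ℝ ^ d`. -/
def unitBallVolume (d : ℕ) : ℝ :=
  Real.pi ^ ((d : ℝ) / 2) / Real.Gamma ((d : ℝ) / 2 + 1)

/-- The Kozachenko-Leonenko entropy estimate computed from a sample `x` of size `N`. -/
def kozachenkoLeonenko {d N : ℕ} (x : Fin N → EuclideanSpace ℝ (Fin d)) : ℝ :=
  d * Real.log (meanNearestNeighborDist x) + Real.log (unitBallVolume d)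
    + Real.eulerMascheroniConstant + Real.log ((N : ℝ) - 1)

/-- The density of a law on `ℝ ^ d` with respect to Lebesgue measure (the law is required
separately to be absolutely continuous). -/
def lebesgueDensity {d : ℕ} (μ : Measure (EuclideanSpace ℝ (Fin d)))
    (x : EuclideanSpace ℝ (Fin d)) : ℝ :=
  (μ.rnDeriv volume x).toReal

/-- The Shannon differential entropy `-∫ f log f` of a density `f` on `ℝ ^ d`. -/
def shannonEntropy {d : ℕ} (f : EuclideanSpace ℝ (Fin d) → ℝ) : ℝ :=
  -∫ x, f x * Real.log (f x)

end

set_option linter.unusedSectionVars false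

/-! Let μ be the law, f its density, N the sample size, and B_i the closed ball about X_i reaching
to its nearest neighbour. The estimate equals the mean of the local errors ξ_i = γ + log(N-1) + log
vol(B_i) + log f(X_i) (`sampleError`) minus the mean of log f(X_i)
(`kozachenkoLeonenko_eq_mean_sampleError`). The mean of log f(X_i) converges in L² because its
variance is O(1/N). It remains to see that the mean of the ξ_i tends to 0 in L². By exchangeability
its second moment is governed by E ξ_0² / N and E ξ_0 ξ_1, so it suffices that E ξ_0² stays bounded
and that E ξ_0 ξ_1 has an upper bound tending to 0; no lower bound is needed.

For small balls vol(B_0) f(X_0) is close to μ(B_0). Given the centre, the μ-probability of the ball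
reaching to the nearest of n further points is distributed as the minimum of n independent uniform
variables, whatever the centre. Its logarithm has mean -`harmonic n`, which log n + γ compensates in
the limit, and the second moment of log((n+1)U) is bounded uniformly in n.

For the cross moment, both radii are cut at half the distance between X_0 and X_1. Balls with radii
p, q below that bound are disjoint, and 1-a-b ≤ (1-a)(1-b) for their probabilities a, b; hence the
events that both balls miss all further points are negatively dependent, and the two truncated
logarithms have nonpositive covariance given the centres
(`HasLogQuadraticDensity.integral_logTruncatedProb_mul_le`). No joint limit law is required.

The price is two errors: the truncation itself, and the replacement of μ(B) by f times volume. Both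
tend to 0 almost surely, since nearest neighbour distances shrink to 0, and both are dominated by
C(1 + ‖x‖² + ‖y‖² + |log dist x y|) for all n (`HasLogQuadraticDensity.exists_error_bound`). This
bound is square integrable because μ has a fourth moment and log dist is controlled by the logarithm
of a uniform variable. The Gaussian law enters only through its moments, its entropy, and a
continuous positive density whose logarithm grows at most quadratically. -/

noncomputable section

/-! ### The density, logarithmic bound and entropy of a nondegenerate Gaussian law. -/

section Gaussian

open scoped RealInnerProductSpace MatrixOrder

variable {E : Type*} [NormedAddCommGroup E] [InnerProductSpace ℝ E] [FiniteDimensional ℝ E]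
  [MeasurableSpace E] [BorelSpace E]

variable (E) in
/-- The density of the standard Gaussian law. -/
def stdGaussianDensity (x : E) : ℝ :=
  (2 * Real.pi) ^ (-((Module.finrank ℝ E : ℝ) / 2)) * Real.exp (-‖x‖ ^ 2 / 2)

lemma stdGaussianDensity_pos (x : E) : 0 < stdGaussianDensity E x := by
  unfold stdGaussianDensity; positivity

lemma continuous_stdGaussianDensity : Continuous (stdGaussianDensity E) := by
  unfold stdGaussianDensity; fun_prop

lemma integrable_stdGaussianDensity : Integrable (stdGaussianDensity E) := by
  have h := (GaussianFourier.integrable_cexp_neg_mul_sq_norm_add (V := E) (b := 1 / 2)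
    (by norm_num) 0 0).norm
  refine (h.const_mul ((2 * Real.pi) ^ (-((Module.finrank ℝ E : ℝ) / 2)))).congr ?_
  refine Eventually.of_forall fun x => ?_
  simp only [stdGaussianDensity, Complex.norm_exp]
  congr 2
  rw [← Complex.ofReal_pow]
  simp [Complex.ofReal_pow]
  rw [← Complex.ofReal_pow, Complex.ofReal_re]
  ring

/-- Both sides are finite measures with characteristic function exp(-‖t‖²/2): on the right this is
the Gaussian Fourier integral with b = 1/2, whose factor (2π)^(dim/2) cancels the normalisation. -/
lemma stdGaussian_eq_withDensity :
    stdGaussian E = volume.withDensity fun x => ENNReal.ofReal (stdGaussianDensity E x) := by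
  have : IsFiniteMeasure (volume.withDensity fun x => ENNReal.ofReal (stdGaussianDensity E x)) :=
    isFiniteMeasure_withDensity_ofReal integrable_stdGaussianDensity.2
  refine Measure.ext_of_charFun (funext fun t => ?_)
  rw [charFun_stdGaussian, charFun_apply, integral_withDensity_eq_integral_toReal_smul
    (by have := continuous_stdGaussianDensity (E := E); fun_prop)
    (Eventually.of_forall fun x => ENNReal.ofReal_lt_top)]
  have h := GaussianFourier.integral_cexp_neg_mul_sq_norm_add (V := E) (b := 1 / 2)
    (by norm_num) Complex.I t
  have h2 : ∀ x : E, (ENNReal.ofReal (stdGaussianDensity E x)).toReal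
      • Complex.exp (⟪x, t⟫ * Complex.I) =
      ((2 * Real.pi) ^ (-((Module.finrank ℝ E : ℝ) / 2)) : ℝ) *
        Complex.exp (-(1 / 2) * ‖x‖ ^ 2 + Complex.I * ⟪t, x⟫) := by
    intro x
    rw [ENNReal.toReal_ofReal (stdGaussianDensity_pos x).le, stdGaussianDensity,
      Complex.real_smul, Complex.ofReal_mul, mul_assoc, Complex.ofReal_exp, ← Complex.exp_add,
      real_inner_comm]
    congr 2
    push_cast
    ring
  simp_rw [h2]
  rw [integral_const_mul, h, ← mul_assoc]
  have h3 : (((2 * Real.pi) ^ (-((Module.finrank ℝ E : ℝ) / 2)) : ℝ) : ℂ) *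
      (Real.pi / (1 / 2) : ℂ) ^ (Module.finrank ℝ E / 2 : ℂ) = 1 := by
    have : (Real.pi / (1 / 2) : ℂ) ^ (Module.finrank ℝ E / 2 : ℂ) =
        (((2 * Real.pi) ^ ((Module.finrank ℝ E : ℝ) / 2) : ℝ) : ℂ) := by
      rw [Complex.ofReal_cpow (by positivity)]
      push_cast
      congr 1
      ring
    rw [this, ← Complex.ofReal_mul, ← Real.rpow_add (by positivity)]
    simp
  rw [h3, one_mul]
  congr 1
  rw [Complex.I_sq]
  ring

lemma map_withDensity_measurableEquiv {α β : Type*} [MeasurableSpace α] [MeasurableSpace β]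
    (m : Measure α) (e : α ≃ᵐ β) {g : α → ENNReal} :
    (m.withDensity g).map e = (m.map e).withDensity (g ∘ e.symm) := by
  ext s hs
  rw [e.map_apply, withDensity_apply _ (e.measurable hs), withDensity_apply _ hs,
    e.restrict_map, lintegral_map_equiv]
  simp

variable {d : ℕ}

/-- The density of the Gaussian law with mean `ν` and nondegenerate covariance `S`. -/
def gaussianDensity (ν : EuclideanSpace ℝ (Fin d)) (S : Matrix (Fin d) (Fin d) ℝ)
    (x : EuclideanSpace ℝ (Fin d)) : ℝ :=
  (Real.sqrt S.det)⁻¹ * stdGaussianDensity (EuclideanSpace ℝ (Fin d))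
    (Matrix.toEuclideanCLM (𝕜 := ℝ) (CFC.sqrt S)⁻¹ (x - ν))

variable {ν : EuclideanSpace ℝ (Fin d)} {S : Matrix (Fin d) (Fin d) ℝ}

lemma det_cfc_sqrt_sq (hS : S.PosDef) : (CFC.sqrt S).det ^ 2 = S.det := by
  rw [pow_two, ← Matrix.det_mul, CFC.sqrt_mul_sqrt_self S hS.posSemidef.nonneg]

lemma isUnit_det_cfc_sqrt (hS : S.PosDef) : IsUnit (CFC.sqrt S).det := by
  rw [isUnit_iff_ne_zero]
  intro h
  have := det_cfc_sqrt_sq hS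
  have := hS.det_pos
  simp_all

lemma abs_det_cfc_sqrt (hS : S.PosDef) : |(CFC.sqrt S).det| = Real.sqrt S.det := by
  rw [← det_cfc_sqrt_sq hS, Real.sqrt_sq_eq_abs]

lemma toEuclideanCLM_inv_apply_apply {A : Matrix (Fin d) (Fin d) ℝ} (hA : IsUnit A.det)
    (x : EuclideanSpace ℝ (Fin d)) :
    Matrix.toEuclideanCLM (𝕜 := ℝ) A⁻¹ (Matrix.toEuclideanCLM (𝕜 := ℝ) A x) = x := by
  rw [← ContinuousLinearMap.comp_apply, ← ContinuousLinearMap.mul_def, ← map_mul,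
    Matrix.nonsing_inv_mul _ hA]
  simp

lemma toEuclideanCLM_apply_inv_apply {A : Matrix (Fin d) (Fin d) ℝ} (hA : IsUnit A.det)
    (x : EuclideanSpace ℝ (Fin d)) :
    Matrix.toEuclideanCLM (𝕜 := ℝ) A (Matrix.toEuclideanCLM (𝕜 := ℝ) A⁻¹ x) = x := by
  rw [← ContinuousLinearMap.comp_apply, ← ContinuousLinearMap.mul_def, ← map_mul,
    Matrix.mul_nonsing_inv _ hA]
  simp

lemma det_toEuclideanCLM (A : Matrix (Fin d) (Fin d) ℝ) :
    LinearMap.det (Matrix.toEuclideanCLM (𝕜 := ℝ) A : EuclideanSpace ℝ (Fin d) →ₗ[ℝ] _) = A.det := by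
  have : (Matrix.toEuclideanCLM (𝕜 := ℝ) A : EuclideanSpace ℝ (Fin d) →ₗ[ℝ] _) =
      Matrix.toLin (EuclideanSpace.basisFun (Fin d) ℝ).toBasis
        (EuclideanSpace.basisFun (Fin d) ℝ).toBasis A := by
    ext x i
    simp [Matrix.toEuclideanCLM]
  rw [this, LinearMap.det_toLin]

lemma gaussianDensity_pos (hS : S.PosDef) (x : EuclideanSpace ℝ (Fin d)) :
    0 < gaussianDensity ν S x :=
  mul_pos (inv_pos.2 (Real.sqrt_pos.2 hS.det_pos)) (stdGaussianDensity_pos _)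

lemma continuous_gaussianDensity : Continuous (gaussianDensity ν S) := by
  have := continuous_stdGaussianDensity (E := EuclideanSpace ℝ (Fin d))
  unfold gaussianDensity
  fun_prop

/-- The law is the image of the standard one under the affine bijection x ↦ ν + √S x, whose Jacobian
is |det √S| = √(det S). -/
lemma multivariateGaussian_eq_withDensity (hS : S.PosDef) :
    multivariateGaussian ν S =
      volume.withDensity fun x => ENNReal.ofReal (gaussianDensity ν S x) := by
  have hu := isUnit_det_cfc_sqrt hS
  set A := CFC.sqrt S with hA
  let e : EuclideanSpace ℝ (Fin d) ≃ᵐ EuclideanSpace ℝ (Fin d) :=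
    { toFun := fun x => ν + Matrix.toEuclideanCLM (𝕜 := ℝ) A x
      invFun := fun x => Matrix.toEuclideanCLM (𝕜 := ℝ) A⁻¹ (x - ν)
      left_inv := fun x => by simp [toEuclideanCLM_inv_apply_apply hu]
      right_inv := fun x => by simp [toEuclideanCLM_apply_inv_apply hu]
      measurable_toFun := (by fun_prop :
        Measurable fun x => ν + Matrix.toEuclideanCLM (𝕜 := ℝ) A x)
      measurable_invFun := (by fun_prop :
        Measurable fun x => Matrix.toEuclideanCLM (𝕜 := ℝ) A⁻¹ (x - ν)) }
  have hvol : (volume : Measure (EuclideanSpace ℝ (Fin d))).map e =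
      ENNReal.ofReal (Real.sqrt S.det)⁻¹ • volume := by
    have h1 : (e : EuclideanSpace ℝ (Fin d) → EuclideanSpace ℝ (Fin d)) = (fun x => ν + x) ∘
      (Matrix.toEuclideanCLM (𝕜 := ℝ) A : EuclideanSpace ℝ (Fin d) →ₗ[ℝ] _) := rfl
    rw [h1, ← Measure.map_map (measurable_const_add ν)
      (LinearMap.continuous_of_finiteDimensional _).measurable,
      Measure.map_linearMap_addHaar_eq_smul_addHaar _
        (by rw [det_toEuclideanCLM]; exact hu.ne_zero), Measure.map_smul,
      map_add_left_eq_self, det_toEuclideanCLM, abs_inv, abs_det_cfc_sqrt hS]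
  calc multivariateGaussian ν S = (stdGaussian (EuclideanSpace ℝ (Fin d))).map e := rfl
    _ = _ := by
      rw [stdGaussian_eq_withDensity, map_withDensity_measurableEquiv, hvol,
        withDensity_smul_measure, ← withDensity_smul]
      · congr 1
        ext x
        simp only [Pi.smul_apply, Function.comp_apply, smul_eq_mul, gaussianDensity]
        rw [ENNReal.ofReal_mul (by positivity)]
        rfl
      · have := continuous_stdGaussianDensity (E := EuclideanSpace ℝ (Fin d))
        exact (by fun_prop : Measurable
          fun x => ENNReal.ofReal (stdGaussianDensity (EuclideanSpace ℝ (Fin d)) x)).comp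
          e.symm.measurable

lemma log_gaussianDensity (hS : S.PosDef) (x : EuclideanSpace ℝ (Fin d)) :
    Real.log (gaussianDensity ν S x) =
      -(1 / 2 * Real.log S.det + d / 2 * Real.log (2 * Real.pi)) -
        ‖Matrix.toEuclideanCLM (𝕜 := ℝ) (CFC.sqrt S)⁻¹ (x - ν)‖ ^ 2 / 2 := by
  have := hS.det_pos
  rw [gaussianDensity, stdGaussianDensity, Real.log_mul (by positivity) (by positivity),
    Real.log_mul (by positivity) (by positivity), Real.log_exp, Real.log_rpow (by positivity),
    Real.log_inv, Real.log_sqrt this.le]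
  simp
  ring

lemma abs_log_gaussianDensity_le (hS : S.PosDef) :
    ∃ K : ℝ, ∀ x, |Real.log (gaussianDensity ν S x)| ≤ K * (1 + ‖x‖ ^ 2) := by
  set B := Matrix.toEuclideanCLM (𝕜 := ℝ) (CFC.sqrt S)⁻¹
  set c := 1 / 2 * Real.log S.det + d / 2 * Real.log (2 * Real.pi)
  refine ⟨|c| + ‖B‖ ^ 2 * (1 + ‖ν‖ ^ 2), fun x => ?_⟩
  rw [log_gaussianDensity hS]
  have h1 : ‖B (x - ν)‖ ^ 2 ≤ ‖B‖ ^ 2 * (2 * ‖x‖ ^ 2 + 2 * ‖ν‖ ^ 2) := by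
    calc ‖B (x - ν)‖ ^ 2 ≤ (‖B‖ * (‖x‖ + ‖ν‖)) ^ 2 := by
          gcongr
          exact (B.le_opNorm _).trans (by gcongr; exact norm_sub_le _ _)
      _ ≤ _ := by
          rw [mul_pow]
          gcongr
          nlinarith [sq_nonneg (‖x‖ - ‖ν‖)]
  have h2 : |(-c - ‖B (x - ν)‖ ^ 2 / 2)| ≤ |c| + ‖B (x - ν)‖ ^ 2 / 2 := by
    refine (abs_sub _ _).trans ?_
    rw [abs_neg, abs_of_nonneg (by positivity : (0 : ℝ) ≤ ‖B (x - ν)‖ ^ 2 / 2)]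
  refine h2.trans ?_
  have h3 : 0 ≤ |c| * ‖x‖ ^ 2 := by positivity
  have h4 : 0 ≤ ‖B‖ ^ 2 * (1 + ‖ν‖ ^ 2 * ‖x‖ ^ 2) := by positivity
  nlinarith

lemma integral_norm_sq_stdGaussian :
    ∫ x, ‖x‖ ^ 2 ∂(stdGaussian (EuclideanSpace ℝ (Fin d))) = d := by
  simp_rw [EuclideanSpace.real_norm_sq_eq]
  have hp : ∀ i : Fin d, MeasurePreserving (fun x : EuclideanSpace ℝ (Fin d) => x i)
      (stdGaussian (EuclideanSpace ℝ (Fin d))) (gaussianReal 0 1) := by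
    intro i
    have := measurePreserving_eval_multivariateGaussian
      (μ := (0 : EuclideanSpace ℝ (Fin d))) (S := 1) Matrix.PosSemidef.one (i := i)
    simpa using this
  have hL : MemLp (fun y : ℝ => y) 2 (gaussianReal 0 1) := IsGaussian.memLp_two_id
  rw [integral_finsetSum]
  · have h : ∀ i : Fin d, ∫ x : EuclideanSpace ℝ (Fin d), x i ^ 2
        ∂(stdGaussian (EuclideanSpace ℝ (Fin d))) = 1 := by
      intro i
      rw [← integral_map (φ := fun x : EuclideanSpace ℝ (Fin d) => x i)
        (f := fun y : ℝ => y ^ 2) (by fun_prop) (by fun_prop), (hp i).map_eq]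
      have hv := variance_of_integral_eq_zero (X := fun y : ℝ => y) (μ := gaussianReal 0 1)
        (by fun_prop) (by simp)
      rw [← hv, variance_fun_id_gaussianReal]
      simp
    simp [h]
  · intro i _
    exact (hp i).integrable_comp_of_integrable hL.integrable_sq

lemma integral_norm_sq_multivariateGaussian (hS : S.PosDef) :
    ∫ x, ‖Matrix.toEuclideanCLM (𝕜 := ℝ) (CFC.sqrt S)⁻¹ (x - ν)‖ ^ 2
      ∂(multivariateGaussian ν S) = d := by
  rw [multivariateGaussian, integral_map (by fun_prop) (by fun_prop)]
  simp only [add_sub_cancel_left, toEuclideanCLM_inv_apply_apply (isUnit_det_cfc_sqrt hS)]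
  exact integral_norm_sq_stdGaussian

lemma integrable_log_gaussianDensity (hS : S.PosDef) :
    Integrable (fun x => Real.log (gaussianDensity ν S x)) (multivariateGaussian ν S) := by
  obtain ⟨K, hK⟩ := abs_log_gaussianDensity_le (ν := ν) hS
  have h2 : Integrable (fun x => ‖x‖ ^ 2) (multivariateGaussian ν S) :=
    (IsGaussian.memLp_two_id (μ := multivariateGaussian ν S)).integrable_norm_pow (by norm_num)
  refine (((integrable_const 1).add h2).const_mul K).mono' ?_ (Eventually.of_forall hK)
  exact (Real.measurable_log.comp continuous_gaussianDensity.measurable).aestronglyMeasurable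

/-- The logarithm of the density is a constant minus half of ‖S^(-1/2)(x-ν)‖², a quantity of mean d;
the resulting d/2 is the factor e^d inside the determinant. -/
lemma integral_log_gaussianDensity (hS : S.PosDef) :
    ∫ x, Real.log (gaussianDensity ν S x) ∂(multivariateGaussian ν S) =
      -(1 / 2 * Real.log (((2 * Real.pi * Real.exp 1) • S).det)) := by
  have h := integral_norm_sq_multivariateGaussian (ν := ν) hS
  have h2 : Integrable (fun x => ‖Matrix.toEuclideanCLM (𝕜 := ℝ) (CFC.sqrt S)⁻¹ (x - ν)‖ ^ 2)
      (multivariateGaussian ν S) := by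
    have := (integrable_log_gaussianDensity (ν := ν) hS).const_mul (-2)
    simp_rw [log_gaussianDensity hS] at this
    refine (this.sub (integrable_const (2 *
      (1 / 2 * Real.log S.det + d / 2 * Real.log (2 * Real.pi))))).congr ?_
    refine Eventually.of_forall fun x => ?_
    simp only [Pi.sub_apply]
    ring
  simp_rw [log_gaussianDensity hS]
  rw [integral_sub (integrable_const _) (h2.div_const 2), integral_div, h, Matrix.det_smul,
    Fintype.card_fin, Real.log_mul (by positivity) hS.det_pos.ne', Real.log_pow,
    Real.log_mul (x := 2 * Real.pi) (by positivity) (by positivity), Real.log_exp]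
  simp
  ring

lemma lebesgueDensity_withDensity {f : EuclideanSpace ℝ (Fin d) → ℝ} (hf : Measurable f)
    (h0 : ∀ x, 0 ≤ f x) :
    lebesgueDensity (volume.withDensity fun x => ENNReal.ofReal (f x)) =ᵐ[volume] f := by
  filter_upwards [Measure.rnDeriv_withDensity volume hf.ennreal_ofReal] with x hx
  rw [lebesgueDensity, hx, ENNReal.toReal_ofReal (h0 x)]

/-- The entropy of a nondegenerate Gaussian law. -/
lemma gaussian_entropy (hS : S.PosDef) :
    multivariateGaussian ν S ≪ (volume : Measure (EuclideanSpace ℝ (Fin d))) ∧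
      Integrable (fun x => lebesgueDensity (multivariateGaussian ν S) x *
        Real.log (lebesgueDensity (multivariateGaussian ν S) x)) ∧
      shannonEntropy (lebesgueDensity (multivariateGaussian ν S)) =
        1 / 2 * Real.log (((2 * Real.pi * Real.exp 1) • S).det) := by
  have hm : Measurable (gaussianDensity ν S) := continuous_gaussianDensity.measurable
  have hd : lebesgueDensity (multivariateGaussian ν S) =ᵐ[volume] gaussianDensity ν S := by
    rw [multivariateGaussian_eq_withDensity hS]
    exact lebesgueDensity_withDensity hm fun x => (gaussianDensity_pos hS x).le
  have hd' : (fun x => lebesgueDensity (multivariateGaussian ν S) x *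
        Real.log (lebesgueDensity (multivariateGaussian ν S) x)) =ᵐ[volume]
      fun x => (ENNReal.ofReal (gaussianDensity ν S x)).toReal •
        Real.log (gaussianDensity ν S x) := by
    filter_upwards [hd] with x hx
    rw [hx, ENNReal.toReal_ofReal (gaussianDensity_pos hS x).le, smul_eq_mul]
  refine ⟨?_, ?_, ?_⟩
  · rw [multivariateGaussian_eq_withDensity hS]
    exact withDensity_absolutelyContinuous _ _
  · rw [integrable_congr hd', ← integrable_withDensity_iff_integrable_smul' hm.ennreal_ofReal
      (Eventually.of_forall fun x => ENNReal.ofReal_lt_top),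
      ← multivariateGaussian_eq_withDensity hS]
    exact integrable_log_gaussianDensity hS
  · rw [shannonEntropy, integral_congr_ae hd',
      ← integral_withDensity_eq_integral_toReal_smul hm.ennreal_ofReal
        (Eventually.of_forall fun x => ENNReal.ofReal_lt_top),
      ← multivariateGaussian_eq_withDensity hS, integral_log_gaussianDensity hS, neg_neg]

end Gaussian

/-! ### The minimum of independent uniform variables: logarithmic moments. -/

section MinUniform

/-- The law of the minimum of `n` independent uniform variables on the unit interval. -/
def minUniformLaw (n : ℕ) : Measure ℝ :=
  (volume.restrict (Set.Ioc 0 1)).withDensity fun u => ENNReal.ofReal (n * (1 - u) ^ (n - 1))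

lemma hasDerivAt_one_sub_pow (n : ℕ) (u : ℝ) :
    HasDerivAt (fun u : ℝ => -(1 - u) ^ n) (n * (1 - u) ^ (n - 1)) u := by
  have := (((hasDerivAt_id u).const_sub 1).fun_pow n).fun_neg
  simpa using this

lemma integral_minUniform_density (n : ℕ) (a : ℝ) :
    ∫ u in (0 : ℝ)..a, n * (1 - u) ^ (n - 1) = 1 - (1 - a) ^ n := by
  rw [intervalIntegral.integral_eq_sub_of_hasDerivAt
    (fun u _ => hasDerivAt_one_sub_pow n u) (Continuous.intervalIntegrable (by fun_prop) _ _)]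
  simp
  ring

lemma minUniform_density_nonneg {n : ℕ} {u : ℝ} (hu : u ≤ 1) :
    0 ≤ (n : ℝ) * (1 - u) ^ (n - 1) :=
  mul_nonneg n.cast_nonneg (pow_nonneg (by linarith) _)

lemma minUniformLaw_Ioc (n : ℕ) {a : ℝ} (h0 : 0 ≤ a) (h1 : a ≤ 1) :
    ∫⁻ u in Set.Ioc 0 a, ENNReal.ofReal (n * (1 - u) ^ (n - 1)) =
      ENNReal.ofReal (1 - (1 - a) ^ n) := by
  rw [← integral_minUniform_density, intervalIntegral.integral_of_le h0,
    ofReal_integral_eq_lintegral_ofReal]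
  · exact (Continuous.integrableOn_Ioc (by fun_prop))
  · filter_upwards [ae_restrict_mem measurableSet_Ioc] with u hu
    exact minUniform_density_nonneg (hu.2.trans h1)

variable {Ω : Type*} [MeasurableSpace Ω] {Q : Measure Ω} [IsProbabilityMeasure Q] {W : Ω → ℝ}
  {n : ℕ}

lemma ae_pos_of_minUniform_tail
    (htail : ∀ u ∈ Set.Ioo (0 : ℝ) 1, Q {ω | u < W ω} = ENNReal.ofReal ((1 - u) ^ n))
    (hW : Measurable W) : ∀ᵐ ω ∂Q, 0 < W ω := by
  have hm : MeasurableSet {ω | 0 < W ω} := measurableSet_lt measurable_const hW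
  refine (mem_ae_iff_prob_eq_one hm).2 ?_
  refine le_antisymm prob_le_one ?_
  have hlim : Tendsto (fun u : ℝ => ENNReal.ofReal ((1 - u) ^ n)) (𝓝[>] 0) (𝓝 1) := by
    have : Continuous fun u : ℝ => ENNReal.ofReal ((1 - u) ^ n) :=
      ENNReal.continuous_ofReal.comp (by fun_prop)
    simpa using (this.tendsto 0).mono_left nhdsWithin_le_nhds
  refine le_of_tendsto hlim ?_
  filter_upwards [Ioo_mem_nhdsGT zero_lt_one] with u hu
  rw [← htail u hu]
  exact measure_mono fun ω (hω : u < W ω) => hu.1.trans hω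

/-- The distribution functions agree. The tail is prescribed only inside the unit interval; outside
it, the bound W ≤ 1 and the almost sure positivity obtained by letting u tend to 0 decide. -/
lemma map_eq_minUniformLaw (hn : 1 ≤ n) (hW : Measurable W) (h1 : ∀ ω, W ω ≤ 1)
    (htail : ∀ u ∈ Set.Ioo (0 : ℝ) 1, Q {ω | u < W ω} = ENNReal.ofReal ((1 - u) ^ n)) :
    Q.map W = minUniformLaw n := by
  have : IsProbabilityMeasure (Q.map W) := Measure.isProbabilityMeasure_map hW.aemeasurable
  refine Measure.ext_of_Iic _ _ fun a => ?_
  rw [Measure.map_apply hW measurableSet_Iic, minUniformLaw, withDensity_apply _ measurableSet_Iic,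
    Measure.restrict_restrict measurableSet_Iic]
  have hset : Set.Iic a ∩ Set.Ioc 0 1 = Set.Ioc 0 (min a 1) := by
    ext u; simp only [Set.mem_inter_iff, Set.mem_Iic, Set.mem_Ioc, le_min_iff]; tauto
  rw [hset]
  rcases le_or_gt a 0 with h0 | h0
  · rw [Set.Ioc_eq_empty (by simp [h0]), Measure.restrict_empty, lintegral_zero_measure]
    have := ae_pos_of_minUniform_tail htail hW
    rw [ae_iff] at this
    refine measure_mono_null (fun ω hω => ?_) this
    simp only [Set.mem_preimage, Set.mem_Iic] at hω
    simpa using hω.trans h0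
  · rw [minUniformLaw_Ioc n (le_min h0.le zero_le_one) (min_le_right _ _)]
    rcases lt_or_ge a 1 with ha | ha
    · have hc : W ⁻¹' Set.Iic a = {ω | a < W ω}ᶜ := by ext; simp
      rw [hc, prob_compl_eq_one_sub (measurableSet_lt measurable_const hW), htail a ⟨h0, ha⟩,
        min_eq_left ha.le, ENNReal.ofReal_sub _ (by bound), ENNReal.ofReal_one]
    · have hc : W ⁻¹' Set.Iic a = Set.univ := by
        ext ω; simpa using (h1 ω).trans ha
      rw [hc, min_eq_right ha, measure_univ]
      simp [zero_pow (by omega : n ≠ 0)]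

lemma integral_minUniformLaw (φ : ℝ → ℝ) :
    ∫ u, φ u ∂(minUniformLaw n) = ∫ u in (0 : ℝ)..1, n * (1 - u) ^ (n - 1) * φ u := by
  rw [minUniformLaw, integral_withDensity_eq_integral_toReal_smul (by fun_prop)
    (Eventually.of_forall fun x => ENNReal.ofReal_lt_top),
    intervalIntegral.integral_of_le zero_le_one]
  refine setIntegral_congr_fun measurableSet_Ioc fun u hu => ?_
  simp only [smul_eq_mul]
  rw [ENNReal.toReal_ofReal (minUniform_density_nonneg hu.2)]

lemma integrable_minUniformLaw_iff (φ : ℝ → ℝ) :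
    Integrable φ (minUniformLaw n) ↔
      IntervalIntegrable (fun u => n * (1 - u) ^ (n - 1) * φ u) volume 0 1 := by
  rw [minUniformLaw, integrable_withDensity_iff_integrable_smul' (by fun_prop)
    (Eventually.of_forall fun x => ENNReal.ofReal_lt_top),
    intervalIntegrable_iff_integrableOn_Ioc_of_le zero_le_one, IntegrableOn]
  refine integrable_congr ?_
  filter_upwards [ae_restrict_mem measurableSet_Ioc] with u hu
  simp only [smul_eq_mul]
  rw [ENNReal.toReal_ofReal (minUniform_density_nonneg hu.2)]

lemma integrable_minUniformLaw_of_intervalIntegrable {φ : ℝ → ℝ}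
    (h : IntervalIntegrable φ volume 0 1) : Integrable φ (minUniformLaw n) := by
  rw [integrable_minUniformLaw_iff]
  exact h.continuousOn_mul (by fun_prop)

/-- This is |log t| t^(1/4) < 4 squared; the exponent -1/2 keeps the bound integrable at 0. -/
lemma log_sq_le_of_le_one {t : ℝ} (ht : 0 < t) (h : t ≤ 1) :
    Real.log t ^ 2 ≤ 16 * t ^ (-(1 / 2) : ℝ) := by
  have h1 := Real.abs_log_mul_self_rpow_lt t (1 / 4) ht h (by norm_num)
  have h2 : (Real.log t * t ^ (1 / 4 : ℝ)) ^ 2 ≤ 16 := by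
    rw [← sq_abs]
    have := abs_nonneg (Real.log t * t ^ (1 / 4 : ℝ))
    nlinarith
  have h3 : (t ^ (1 / 4 : ℝ)) ^ 2 = t ^ (1 / 2 : ℝ) := by
    rw [← Real.rpow_natCast, ← Real.rpow_mul ht.le]; norm_num
  rw [mul_pow, h3] at h2
  rw [Real.rpow_neg ht.le, ← div_eq_mul_inv, le_div_iff₀ (by positivity)]
  exact h2

lemma log_sq_le_of_one_le {t : ℝ} (h : 1 ≤ t) : Real.log t ^ 2 ≤ 4 * t := by
  have ht : 0 < t := by linarith
  have h1 := Real.log_le_rpow_div ht.le (ε := 1 / 2) (by norm_num)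
  have h2 : (t ^ (1 / 2 : ℝ)) ^ 2 = t := by
    rw [← Real.rpow_natCast, ← Real.rpow_mul ht.le]; norm_num
  have h3 := Real.log_nonneg h
  have h5 : Real.log t ^ 2 ≤ (t ^ (1 / 2 : ℝ) / (1 / 2)) ^ 2 := by gcongr
  rw [div_pow, h2] at h5
  norm_num at h5
  linarith

lemma integrable_log_sq_minUniformLaw : Integrable (fun u => Real.log u ^ 2) (minUniformLaw n) := by
  have h : Integrable (fun u : ℝ => 16 * u ^ (-(1 / 2) : ℝ)) (minUniformLaw n) := by
    refine integrable_minUniformLaw_of_intervalIntegrable ?_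
    exact (intervalIntegral.intervalIntegrable_rpow' (by norm_num)).const_mul 16
  refine h.mono' (by fun_prop) ?_
  rw [minUniformLaw]
  refine (withDensity_absolutelyContinuous _ _).ae_le ?_
  filter_upwards [ae_restrict_mem measurableSet_Ioc] with u hu
  rw [Real.norm_of_nonneg (sq_nonneg _)]
  exact log_sq_le_of_le_one hu.1 hu.2

lemma integral_log_minUniformLaw : ∫ u, Real.log u ∂(minUniformLaw n) = -(harmonic n : ℝ) := by
  rw [integral_minUniformLaw]
  -- The antiderivative from integration by parts. Writing 1 - (1-u)^n as u times a geometric sum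
  -- makes it visibly continuous at 0, since u log u is. Its values are `harmonic n` at 0 and 0 at
  -- 1.
  set F : ℝ → ℝ := fun u => (u * Real.log u) * (∑ k ∈ Finset.range n, (1 - u) ^ k) +
    ∑ k ∈ Finset.range n, (1 - u) ^ (k + 1) / (k + 1) with hF
  have hgeom : ∀ u : ℝ, u * ∑ k ∈ Finset.range n, (1 - u) ^ k = 1 - (1 - u) ^ n := by
    intro u
    have := mul_neg_geom_sum (1 - u) n
    rwa [sub_sub_cancel] at this
  have hcont : Continuous F := by
    have := Real.continuous_mul_log
    fun_prop
  have hderiv : ∀ u ∈ Set.Ioo (0 : ℝ) 1,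
      HasDerivAt F (n * (1 - u) ^ (n - 1) * Real.log u) u := by
    intro u hu
    have hF2 : F = fun u => (1 + -(1 - u) ^ n) * Real.log u +
        ∑ k ∈ Finset.range n, -(-(1 - u) ^ (k + 1)) / (k + 1) := by
      funext v
      simp only [hF]
      rw [mul_right_comm, hgeom]
      simp [sub_eq_add_neg]
    rw [hF2]
    have h1 := ((hasDerivAt_one_sub_pow n u).const_add 1).mul (Real.hasDerivAt_log hu.1.ne')
    have h2 := HasDerivAt.fun_sum (u := Finset.range n) fun k _ =>
      ((hasDerivAt_one_sub_pow (k + 1) u).neg.div_const ((k : ℝ) + 1))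
    refine (h1.add h2).congr_deriv ?_
    have h3 : ∑ k ∈ Finset.range n, -(((k + 1 : ℕ) : ℝ) * (1 - u) ^ (k + 1 - 1)) / ((k : ℝ) + 1) =
        -∑ k ∈ Finset.range n, (1 - u) ^ k := by
      rw [← Finset.sum_neg_distrib]
      refine Finset.sum_congr rfl fun k _ => ?_
      push_cast
      field_simp
    rw [h3, ← sub_eq_add_neg 1, ← hgeom]
    have := hu.1.ne'
    field_simp
    ring
  have hint : IntervalIntegrable (fun u => n * (1 - u) ^ (n - 1) * Real.log u) volume 0 1 :=
    (intervalIntegral.intervalIntegrable_log').continuousOn_mul (by fun_prop)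
  rw [intervalIntegral.integral_eq_sub_of_hasDerivAt_of_le zero_le_one hcont.continuousOn hderiv
    hint]
  simp [hF, harmonic]

lemma integral_id_minUniformLaw (hn : 1 ≤ n) : ∫ u, u ∂(minUniformLaw n) = 1 / ((n : ℝ) + 1) := by
  rw [integral_minUniformLaw]
  have h : ∀ u : ℝ, HasDerivAt (fun u : ℝ => u * (-(1 - u) ^ n) + -(1 - u) ^ (n + 1) / (n + 1))
      (n * (1 - u) ^ (n - 1) * u) u := by
    intro u
    have h1 := (hasDerivAt_id u).mul (hasDerivAt_one_sub_pow n u)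
    have h2 := (hasDerivAt_one_sub_pow (n + 1) u).div_const ((n : ℝ) + 1)
    refine (h1.add h2).congr_deriv ?_
    push_cast
    simp
    field_simp
    ring
  rw [intervalIntegral.integral_eq_sub_of_hasDerivAt (fun u _ => h u)
    (Continuous.intervalIntegrable (by fun_prop) _ _)]
  simp [zero_pow (by omega : n ≠ 0)]
  ring

lemma intervalIntegrable_of_integrable_minUniformLaw {φ : ℝ → ℝ} {a b : ℝ}
    (h : Integrable φ (minUniformLaw n)) (ha : a ∈ Set.Icc (0 : ℝ) 1) (hb : b ∈ Set.Icc (0 : ℝ) 1) :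
    IntervalIntegrable (fun u => n * (1 - u) ^ (n - 1) * φ u) volume a b := by
  refine ((integrable_minUniformLaw_iff φ).1 h).mono_set ?_
  rw [Set.uIcc_of_le zero_le_one]
  exact Set.uIcc_subset_Icc ha hb

lemma measurable_log_mul_sq (c : ℝ) : Measurable fun u : ℝ => Real.log (c * u) ^ 2 :=
  (Real.measurable_log.comp (measurable_const_mul c)).pow_const 2

lemma integrable_log_mul_sq_minUniformLaw :
    Integrable (fun u => Real.log (((n : ℝ) + 1) * u) ^ 2) (minUniformLaw n) := by
  have : IsFiniteMeasure (minUniformLaw n) := by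
    refine ⟨?_⟩
    rw [minUniformLaw, withDensity_apply _ MeasurableSet.univ, Measure.restrict_univ,
      minUniformLaw_Ioc n zero_le_one le_rfl]
    exact ENNReal.ofReal_lt_top
  refine Integrable.mono' ((integrable_const (2 * Real.log ((n : ℝ) + 1) ^ 2)).add
    (integrable_log_sq_minUniformLaw.const_mul 2))
    (measurable_log_mul_sq _).aestronglyMeasurable ?_
  rw [minUniformLaw]
  refine (withDensity_absolutelyContinuous _ _).ae_le ?_
  filter_upwards [ae_restrict_mem measurableSet_Ioc] with u hu
  rw [Real.norm_of_nonneg (sq_nonneg _), Real.log_mul (by positivity) hu.1.ne']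
  simp only [Pi.add_apply]
  nlinarith [sq_nonneg (Real.log ((n : ℝ) + 1) - Real.log u)]

/-- The minimum lives on the scale a = 1/(n+1). Below a the density is at most n and log² t ≤ 16
t^(-1/2), which contributes at most 32; above a, log² t ≤ 4t and the mean 1/(n+1) of the minimum
contribute at most 4. What matters is that the bound is free of n. -/
lemma integral_log_mul_sq_minUniformLaw_le (hn : 1 ≤ n) :
    ∫ u, Real.log (((n : ℝ) + 1) * u) ^ 2 ∂(minUniformLaw n) ≤ 36 := by
  have hN : (0 : ℝ) < (n : ℝ) + 1 := by positivity
  set a : ℝ := ((n : ℝ) + 1)⁻¹ with ha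
  have ha0 : 0 < a := by positivity
  have ha1 : a ≤ 1 := inv_le_one_of_one_le₀ (by linarith [n.cast_nonneg (α := ℝ)])
  have hna : ((n : ℝ) + 1) * a = 1 := mul_inv_cancel₀ hN.ne'
  have hI := integrable_log_mul_sq_minUniformLaw (n := n)
  have haI : a ∈ Set.Icc (0 : ℝ) 1 := ⟨ha0.le, ha1⟩
  have h0I : (0 : ℝ) ∈ Set.Icc (0 : ℝ) 1 := by simp
  have h1I : (1 : ℝ) ∈ Set.Icc (0 : ℝ) 1 := by simp
  rw [integral_minUniformLaw, ← intervalIntegral.integral_add_adjacent_intervals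
    (intervalIntegrable_of_integrable_minUniformLaw hI h0I haI)
    (intervalIntegrable_of_integrable_minUniformLaw hI haI h1I)]
  have hsmall : ∫ u in (0 : ℝ)..a, n * (1 - u) ^ (n - 1) * Real.log (((n : ℝ) + 1) * u) ^ 2 ≤ 32 := by
    -- The integral of u^(-1/2) up to a is 2√a, so the value is 32 n a with n a ≤ 1.
    have hb : ∫ u in (0 : ℝ)..a, 16 * (n * (((n : ℝ) + 1) ^ (-(1 / 2) : ℝ)) * u ^ (-(1 / 2) : ℝ))
        ≤ 32 := by
      rw [intervalIntegral.integral_const_mul, intervalIntegral.integral_const_mul,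
        integral_rpow (Or.inl (by norm_num))]
      have h2 : ((n : ℝ) + 1) ^ (-(1 / 2) : ℝ) = a ^ (1 / 2 : ℝ) := by
        rw [Real.rpow_neg hN.le, ha, Real.inv_rpow hN.le]
      have h3 : a ^ (1 / 2 : ℝ) * a ^ (1 / 2 : ℝ) = a := by
        rw [← Real.rpow_add ha0]; norm_num
      have h4 : (-(1 / 2) + 1 : ℝ) = 1 / 2 := by norm_num
      rw [h2, h4, Real.zero_rpow (by norm_num), sub_zero]
      calc 16 * (n * a ^ (1 / 2 : ℝ) * (a ^ (1 / 2 : ℝ) / (1 / 2)))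
          = 32 * (n * (a ^ (1 / 2 : ℝ) * a ^ (1 / 2 : ℝ))) := by ring
        _ ≤ 32 := by rw [h3]; nlinarith
    refine (intervalIntegral.integral_mono_on_of_le_Ioo ha0.le
      (intervalIntegrable_of_integrable_minUniformLaw hI h0I haI) ?_ fun u hu => ?_).trans hb
    · exact ((intervalIntegral.intervalIntegrable_rpow' (by norm_num)).const_mul _).const_mul _
    · have ht : ((n : ℝ) + 1) * u ≤ 1 := (mul_le_mul_of_nonneg_left hu.2.le hN.le).trans_eq hna
      have h1 := log_sq_le_of_le_one (mul_pos hN hu.1) ht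
      rw [Real.mul_rpow hN.le hu.1.le] at h1
      have h2 : (1 - u) ^ (n - 1) ≤ 1 :=
        pow_le_one₀ (by linarith [hu.2]) (by linarith [hu.1])
      calc n * (1 - u) ^ (n - 1) * Real.log (((n : ℝ) + 1) * u) ^ 2
          ≤ n * 1 * (16 * (((n : ℝ) + 1) ^ (-(1 / 2) : ℝ) * u ^ (-(1 / 2) : ℝ))) := by gcongr
        _ = _ := by ring
  have hlarge : ∫ u in a..1, n * (1 - u) ^ (n - 1) * Real.log (((n : ℝ) + 1) * u) ^ 2 ≤ 4 := by
    have hid := integral_id_minUniformLaw hn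
    rw [integral_minUniformLaw] at hid
    have hc : ∀ b c : ℝ, IntervalIntegrable (fun u : ℝ => n * (1 - u) ^ (n - 1) * u) volume b c :=
      fun b c => Continuous.intervalIntegrable (by fun_prop) _ _
    have hsplit := intervalIntegral.integral_add_adjacent_intervals (hc 0 a) (hc a 1)
    have hpos : 0 ≤ ∫ u in (0 : ℝ)..a, n * (1 - u) ^ (n - 1) * u :=
      intervalIntegral.integral_nonneg ha0.le fun u hu =>
        mul_nonneg (minUniform_density_nonneg (hu.2.trans ha1)) hu.1
    have hle : ∫ u in a..1, n * (1 - u) ^ (n - 1) * u ≤ a := by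
      have : a = 1 / ((n : ℝ) + 1) := by rw [ha, one_div]
      linarith
    calc _ ≤ ∫ u in a..1, (4 * ((n : ℝ) + 1)) * (n * (1 - u) ^ (n - 1) * u) := by
          refine intervalIntegral.integral_mono_on ha1
            (intervalIntegrable_of_integrable_minUniformLaw hI haI h1I)
            ((hc a 1).const_mul _) fun u hu => ?_
          have ht : 1 ≤ ((n : ℝ) + 1) * u := hna.symm.trans_le (mul_le_mul_of_nonneg_left hu.1 hN.le)
          have := mul_le_mul_of_nonneg_left (log_sq_le_of_one_le ht)
            (minUniform_density_nonneg (n := n) hu.2)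
          linarith
      _ = (4 * ((n : ℝ) + 1)) * ∫ u in a..1, n * (1 - u) ^ (n - 1) * u :=
          intervalIntegral.integral_const_mul _ _
      _ ≤ (4 * ((n : ℝ) + 1)) * a := by gcongr
      _ = 4 := by rw [mul_assoc, hna, mul_one]
  linarith

lemma memLp_log_of_minUniform_tail (hn : 1 ≤ n) (hW : Measurable W) (h1 : ∀ ω, W ω ≤ 1)
    (htail : ∀ u ∈ Set.Ioo (0 : ℝ) 1, Q {ω | u < W ω} = ENNReal.ofReal ((1 - u) ^ n)) :
    MemLp (fun ω => Real.log (W ω)) 2 Q := by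
  have h := integrable_log_sq_minUniformLaw (n := n)
  rw [← map_eq_minUniformLaw hn hW h1 htail] at h
  exact (memLp_two_iff_integrable_sq (Real.measurable_log.comp hW).aestronglyMeasurable).2
    (h.comp_measurable hW)

lemma integral_log_of_minUniform_tail (hn : 1 ≤ n) (hW : Measurable W) (h1 : ∀ ω, W ω ≤ 1)
    (htail : ∀ u ∈ Set.Ioo (0 : ℝ) 1, Q {ω | u < W ω} = ENNReal.ofReal ((1 - u) ^ n)) :
    ∫ ω, Real.log (W ω) ∂Q = -(harmonic n : ℝ) := by
  rw [← integral_log_minUniformLaw, ← map_eq_minUniformLaw hn hW h1 htail,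
    integral_map hW.aemeasurable Real.measurable_log.aestronglyMeasurable]

lemma integral_log_mul_sq_le_of_minUniform_tail (hn : 1 ≤ n) (hW : Measurable W)
    (h1 : ∀ ω, W ω ≤ 1)
    (htail : ∀ u ∈ Set.Ioo (0 : ℝ) 1, Q {ω | u < W ω} = ENNReal.ofReal ((1 - u) ^ n)) :
    ∫ ω, Real.log (((n : ℝ) + 1) * W ω) ^ 2 ∂Q ≤ 36 := by
  have h := integral_log_mul_sq_minUniformLaw_le hn
  rwa [← map_eq_minUniformLaw hn hW h1 htail,
    integral_map hW.aemeasurable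
      (measurable_log_mul_sq _).aestronglyMeasurable] at h

end MinUniform

/-! ### Probabilities of balls under a density with quadratically bounded logarithm. -/

section BallProbability

variable {E : Type*} [NormedAddCommGroup E] [InnerProductSpace ℝ E] [FiniteDimensional ℝ E]
  [MeasurableSpace E] [BorelSpace E]

/-- The law `μ` has a continuous positive density `f` whose logarithm grows at most
quadratically. -/
structure HasLogQuadraticDensity (μ : Measure E) (f : E → ℝ) : Prop where
  eq_withDensity : μ = volume.withDensity fun x => ENNReal.ofReal (f x)
  continuous : Continuous f
  pos : ∀ x, 0 < f x
  exists_abs_log_le : ∃ K : ℝ, ∀ x, |Real.log (f x)| ≤ K * (1 + ‖x‖ ^ 2)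

variable {μ : Measure E} {f : E → ℝ}

lemma measurable_ballProb [SFinite μ] :
    Measurable fun p : E × ℝ => μ.real (Metric.closedBall p.1 p.2) := by
  have hs : MeasurableSet {q : (E × ℝ) × E | dist q.2 q.1.1 ≤ q.1.2} :=
    measurableSet_le (by fun_prop) (by fun_prop)
  exact (measurable_measure_prodMk_left hs).ennreal_toReal

namespace HasLogQuadraticDensity

lemma continuous_log (h : HasLogQuadraticDensity μ f) : Continuous fun x => Real.log (f x) :=
  h.continuous.log fun x => (h.pos x).ne'

lemma isOpenPosMeasure (h : HasLogQuadraticDensity μ f) : μ.IsOpenPosMeasure := by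
  have : (volume : Measure E) ≪ μ := by
    rw [h.eq_withDensity]
    exact withDensity_absolutelyContinuous' h.continuous.measurable.ennreal_ofReal.aemeasurable
      (Eventually.of_forall fun x => by simpa using h.pos x)
  exact this.isOpenPosMeasure

lemma absolutelyContinuous (h : HasLogQuadraticDensity μ f) : μ ≪ volume := by
  rw [h.eq_withDensity]
  exact withDensity_absolutelyContinuous _ _

lemma noAtoms [Nontrivial E] (h : HasLogQuadraticDensity μ f) : NullSingletonClass μ :=
  ⟨fun x => h.absolutelyContinuous (measure_singleton x)⟩

variable [IsProbabilityMeasure μ]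

/-- On the ball the density lies between exp(a-b) and exp(a+b), hence so does the ratio of
probability to volume. The choice a = 0 gives the global quadratic bound; a = log f(x) with small b
gives the limit at small radii. -/
lemma abs_log_ballProb_sub_le (h : HasLogQuadraticDensity μ f) {x : E} {r a b : ℝ} (hr : 0 < r)
    (hb : ∀ z ∈ Metric.closedBall x r, |Real.log (f z) - a| ≤ b) :
    |Real.log (μ.real (Metric.closedBall x r)) -
      Real.log (volume.real (Metric.closedBall x r)) - a| ≤ b := by
  set B := Metric.closedBall x r
  have hB : MeasurableSet B := Metric.isClosed_closedBall.measurableSet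
  have hfin : volume B ≠ ⊤ := measure_closedBall_lt_top.ne
  have hvol : 0 < volume.real B := ENNReal.toReal_pos
    (Metric.measure_closedBall_pos _ _ hr).ne' hfin
  have hlow : Real.exp (a - b) * volume.real B ≤ μ.real B := by
    have h1 : ENNReal.ofReal (Real.exp (a - b)) * volume B ≤ μ B := by
      rw [h.eq_withDensity, withDensity_apply _ hB, ← setLIntegral_const]
      refine setLIntegral_mono' hB fun z hz => ENNReal.ofReal_le_ofReal ?_
      rw [← Real.le_log_iff_exp_le (h.pos z)]
      linarith [(abs_le.1 (hb z hz)).1]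
    have := ENNReal.toReal_mono (measure_ne_top _ _) h1
    rwa [ENNReal.toReal_mul, ENNReal.toReal_ofReal (Real.exp_pos _).le] at this
  have hup : μ.real B ≤ Real.exp (a + b) * volume.real B := by
    have h1 : μ B ≤ ENNReal.ofReal (Real.exp (a + b)) * volume B := by
      rw [h.eq_withDensity, withDensity_apply _ hB, ← setLIntegral_const]
      refine setLIntegral_mono' hB fun z hz => ENNReal.ofReal_le_ofReal ?_
      rw [← Real.log_le_iff_le_exp (h.pos z)]
      linarith [(abs_le.1 (hb z hz)).2]
    have := ENNReal.toReal_mono (ENNReal.mul_ne_top ENNReal.ofReal_ne_top hfin) h1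
    rwa [ENNReal.toReal_mul, ENNReal.toReal_ofReal (Real.exp_pos _).le] at this
  have hμ : 0 < μ.real B := lt_of_lt_of_le (by positivity) hlow
  have h1 := Real.log_le_log (by positivity) hlow
  have h2 := Real.log_le_log hμ hup
  rw [Real.log_mul (Real.exp_pos _).ne' hvol.ne', Real.log_exp] at h1 h2
  rw [abs_le]
  constructor <;> linarith

lemma exists_abs_log_ballProb_le (h : HasLogQuadraticDensity μ f) :
    ∃ K : ℝ, 0 ≤ K ∧ (∀ x, |Real.log (f x)| ≤ K * (1 + ‖x‖ ^ 2)) ∧ ∀ x r, 0 < r →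
      |Real.log (μ.real (Metric.closedBall x r)) -
        Real.log (volume.real (Metric.closedBall x r))| ≤ K * (1 + ‖x‖ ^ 2 + r ^ 2) := by
  obtain ⟨K, hK⟩ := h.exists_abs_log_le
  have hK0 : 0 ≤ K := by simpa using (abs_nonneg _).trans (hK 0)
  refine ⟨2 * K, by positivity, fun x => (hK x).trans ?_, fun x r hr => ?_⟩
  · have : 0 ≤ K * (1 + ‖x‖ ^ 2) := by positivity
    linarith
  have := h.abs_log_ballProb_sub_le (x := x) (a := 0) (b := 2 * K * (1 + ‖x‖ ^ 2 + r ^ 2)) hr ?_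
  · simpa using this
  · intro z hz
    rw [sub_zero]
    refine (hK z).trans ?_
    have h1 : ‖z‖ ≤ ‖x‖ + r := by
      have := norm_le_norm_add_norm_sub' z x
      rw [mem_closedBall_iff_norm] at hz
      linarith
    have h2 : ‖z‖ ^ 2 ≤ 2 * ‖x‖ ^ 2 + 2 * r ^ 2 := by
      have : ‖z‖ ^ 2 ≤ (‖x‖ + r) ^ 2 := by gcongr
      nlinarith [sq_nonneg (‖x‖ - r)]
    nlinarith

lemma tendsto_log_ballProb_sub (h : HasLogQuadraticDensity μ f) (x : E) :
    Tendsto (fun r => Real.log (μ.real (Metric.closedBall x r)) -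
      Real.log (volume.real (Metric.closedBall x r))) (𝓝[>] 0) (𝓝 (Real.log (f x))) := by
  rw [Metric.tendsto_nhds]
  intro ε hε
  obtain ⟨δ, hδ, hball⟩ := Metric.continuousAt_iff.1 (h.continuous_log.continuousAt (x := x))
    (ε / 2) (half_pos hε)
  filter_upwards [Ioo_mem_nhdsGT hδ] with r hr
  rw [Real.dist_eq]
  refine (h.abs_log_ballProb_sub_le hr.1 fun z hz => ?_).trans_lt (half_lt_self hε)
  rw [← Real.dist_eq]
  exact (hball ((Metric.mem_closedBall.1 hz).trans_lt hr.2)).le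

variable [Nontrivial E]

lemma ballProb_strictMono (h : HasLogQuadraticDensity μ f) (x : E) {r s : ℝ} (hr : 0 ≤ r)
    (hrs : r < s) : μ.real (Metric.closedBall x r) < μ.real (Metric.closedBall x s) := by
  have := h.isOpenPosMeasure
  -- A point halfway between the two spheres shows that the open annulus is nonempty, so it has
  -- positive mass.
  obtain ⟨z, hz⟩ := exists_norm_eq E (c := (r + s) / 2) (by linarith)
  have hopen : IsOpen (Metric.ball x s \ Metric.closedBall x r) :=
    Metric.isOpen_ball.sdiff Metric.isClosed_closedBall
  have hpos : 0 < μ.real (Metric.ball x s \ Metric.closedBall x r) := by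
    refine ENNReal.toReal_pos (hopen.measure_pos μ ⟨x + z, ?_⟩).ne' (measure_ne_top _ _)
    simp only [Set.mem_sdiff, Metric.mem_ball, Metric.mem_closedBall, dist_self_add_left, hz]
    constructor <;> linarith
  have hle : μ.real (Metric.ball x s \ Metric.closedBall x r) + μ.real (Metric.closedBall x r) ≤
      μ.real (Metric.closedBall x s) := by
    rw [← measureReal_union Set.disjoint_sdiff_left Metric.isClosed_closedBall.measurableSet]
    refine measureReal_mono (Set.union_subset (Set.sdiff_subset.trans Metric.ball_subset_closedBall)
      (Metric.closedBall_subset_closedBall hrs.le))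
  linarith

/-- Spheres are null, so the distribution function of the distance to x is continuous and takes the
value u. The final equivalence, due to strict monotonicity in the radius, turns events about ball
probabilities into events about distances. -/
lemma exists_ballProb_eq (h : HasLogQuadraticDensity μ f) (x : E) {u : ℝ}
    (hu : u ∈ Set.Ioo (0 : ℝ) 1) :
    ∃ r, 0 < r ∧ μ.real (Metric.closedBall x r) = u ∧
      ∀ s, u < μ.real (Metric.closedBall x s) ↔ r < s := by
  have := h.noAtoms
  set m := μ.map fun z => dist z x with hm
  have hmeas : Measurable fun z : E => dist z x := by fun_prop
  have : IsProbabilityMeasure m := Measure.isProbabilityMeasure_map hmeas.aemeasurable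
  have hcdf : ∀ r, cdf m r = μ.real (Metric.closedBall x r) := fun r => by
    rw [cdf_eq_real, hm, map_measureReal_apply hmeas measurableSet_Iic]
    rfl
  have hcont : Continuous (cdf m) := by
    refine continuous_iff_continuousAt.2 fun r => ?_
    rw [(cdf m).mono.continuousAt_iff_leftLim_eq_rightLim, (cdf m).rightLim_eq]
    -- The jump of the distribution function at r is the mass of the sphere of radius r.
    have h0 : (cdf m).measure {r} = 0 := by
      rw [measure_cdf, hm, Measure.map_apply hmeas (measurableSet_singleton r)]
      exact h.absolutelyContinuous (Measure.addHaar_sphere volume x r)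
    rw [StieltjesFunction.measure_singleton, ENNReal.ofReal_eq_zero] at h0
    exact le_antisymm ((cdf m).mono.leftLim_le le_rfl) (by linarith)
  have h0 : cdf m 0 = 0 := by simp [hcdf, measureReal_def, measure_singleton x]
  obtain ⟨R, hR, hR0⟩ := (((tendsto_cdf_atTop m).eventually (eventually_gt_nhds hu.2)).and
    (eventually_ge_atTop 0)).exists
  obtain ⟨r, hr, hru⟩ := intermediate_value_Icc hR0 hcont.continuousOn
    (show u ∈ Set.Icc (cdf m 0) (cdf m R) from ⟨by rw [h0]; exact hu.1.le, hR.le⟩)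
  have hr0 : 0 < r := by
    refine lt_of_le_of_ne hr.1 fun hr0 => ?_
    rw [← hr0, h0] at hru
    exact hu.1.ne hru
  rw [hcdf] at hru
  refine ⟨r, hr0, hru, fun s => ⟨fun hs => ?_, fun hs => ?_⟩⟩
  · by_contra! hsr
    rw [← hru] at hs
    exact hs.not_ge (measureReal_mono (Metric.closedBall_subset_closedBall hsr))
  · rw [← hru]
    exact h.ballProb_strictMono x hr0.le hs

lemma ballProb_zero (h : HasLogQuadraticDensity μ f) (x : E) {r : ℝ} (hr : r ≤ 0) :
    μ.real (Metric.closedBall x r) = 0 := by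
  have := h.noAtoms
  rcases hr.lt_or_eq with h1 | rfl
  · rw [Metric.closedBall_eq_empty.2 h1, measureReal_empty]
  · simp [measureReal_def, measure_singleton x]

lemma ballProb_pos_iff (h : HasLogQuadraticDensity μ f) (x : E) {r : ℝ} :
    0 < μ.real (Metric.closedBall x r) ↔ 0 < r := by
  refine ⟨fun hp => ?_, fun hr => ?_⟩
  · by_contra! hr
    exact hp.ne' (h.ballProb_zero x hr)
  · rw [← h.ballProb_zero x le_rfl]
    exact h.ballProb_strictMono x le_rfl hr

end HasLogQuadraticDensity

lemma log_volume_closedBall [Nontrivial E] (x : E) {r : ℝ} (hr : 0 < r) :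
    Real.log (volume.real (Metric.closedBall x r)) =
      Module.finrank ℝ E * Real.log r + Real.log (volume.real (Metric.closedBall (0 : E) 1)) := by
  have hv : 0 < volume.real (Metric.closedBall (0 : E) 1) := ENNReal.toReal_pos
    (Metric.measure_closedBall_pos _ _ one_pos).ne' measure_closedBall_lt_top.ne
  rw [Measure.addHaar_real_closedBall' _ _ hr.le, Real.log_mul (by positivity) hv.ne', Real.log_pow]

end BallProbability

/-! ### From negatively dependent tails to nonpositive covariance. -/

section NegativeDependence

variable {Ω : Type*} [MeasurableSpace Ω] {Q : Measure Ω} [IsProbabilityMeasure Q]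

/-- Nonnegative random variables whose upper tails are negatively dependent have
nonpositive covariance. -/
lemma lintegral_mul_le_of_tail_le {G K : Ω → ℝ} (hG : Measurable G) (hK : Measurable K)
    (hG0 : 0 ≤ᵐ[Q] G) (hK0 : 0 ≤ᵐ[Q] K)
    (h : ∀ s > 0, ∀ t > 0, Q ({ω | s ≤ G ω} ∩ {ω | t ≤ K ω}) ≤
      Q {ω | s ≤ G ω} * Q {ω | t ≤ K ω}) :
    ∫⁻ ω, ENNReal.ofReal (G ω) * ENNReal.ofReal (K ω) ∂Q ≤
      (∫⁻ ω, ENNReal.ofReal (G ω) ∂Q) * ∫⁻ ω, ENNReal.ofReal (K ω) ∂Q := by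
  have hGs : ∀ s, MeasurableSet {ω | s ≤ G ω} := fun s => measurableSet_le measurable_const hG
  have hKt : ∀ t, MeasurableSet {ω | t ≤ K ω} := fun t => measurableSet_le measurable_const hK
  have hstep : ∀ s > 0, ∫⁻ ω in {ω | s ≤ G ω}, ENNReal.ofReal (K ω) ∂Q ≤
      Q {ω | s ≤ G ω} * ∫⁻ ω, ENNReal.ofReal (K ω) ∂Q := by
    intro s hs
    rw [lintegral_eq_lintegral_meas_le _ (ae_restrict_of_ae hK0) hK.aemeasurable,
      lintegral_eq_lintegral_meas_le _ hK0 hK.aemeasurable, ← lintegral_const_mul' _ _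
        (measure_ne_top _ _)]
    refine setLIntegral_mono' measurableSet_Ioi fun t ht => ?_
    rw [Measure.restrict_apply (hKt t), Set.inter_comm]
    exact h s hs t ht
  -- With K absorbed into the measure as a density, the layer cake formula applies to G alone; the
  -- layers are then estimated by `hstep`, itself the layer cake formula for K.
  have hmul : ∫⁻ ω, ENNReal.ofReal (G ω) * ENNReal.ofReal (K ω) ∂Q =
      ∫⁻ ω, ENNReal.ofReal (G ω) ∂(Q.withDensity fun ω => ENNReal.ofReal (K ω)) := by
    rw [lintegral_withDensity_eq_lintegral_mul _ hK.ennreal_ofReal hG.ennreal_ofReal]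
    simp only [Pi.mul_apply, mul_comm]
  rw [hmul, lintegral_eq_lintegral_meas_le _ ((withDensity_absolutelyContinuous _ _).ae_le hG0)
    hG.aemeasurable]
  calc _ ≤ ∫⁻ s in Set.Ioi (0 : ℝ), Q {ω | s ≤ G ω} * ∫⁻ ω, ENNReal.ofReal (K ω) ∂Q := by
        refine setLIntegral_mono' measurableSet_Ioi fun s hs => ?_
        rw [withDensity_apply _ (hGs s)]
        exact hstep s hs
    _ = _ := by
        rw [lintegral_mul_const'', ← lintegral_eq_lintegral_meas_le _ hG0 hG.aemeasurable]
        exact (Antitone.measurable fun a b hab =>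
          measure_mono fun ω (hω : b ≤ G ω) => hab.trans hω).aemeasurable

/-- The variables -log W and -log Z are nonnegative almost surely, and their upper tails are lower
tails of W and Z. Negative dependence passes from two events to their complements, so the covariance
inequality applies, and the two signs cancel. -/
lemma integral_log_mul_log_le {W Z : Ω → ℝ} (hW : Measurable W) (hZ : Measurable Z)
    (hW1 : ∀ ω, W ω ≤ 1) (hZ1 : ∀ ω, Z ω ≤ 1)
    (hW0 : ∀ᵐ ω ∂Q, 0 < W ω) (hZ0 : ∀ᵐ ω ∂Q, 0 < Z ω)
    (hWL : MemLp (fun ω => Real.log (W ω)) 2 Q) (hZL : MemLp (fun ω => Real.log (Z ω)) 2 Q)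
    (h : ∀ u ∈ Set.Ioo (0 : ℝ) 1, ∀ v ∈ Set.Ioo (0 : ℝ) 1,
      Q ({ω | u < W ω} ∩ {ω | v < Z ω}) ≤ Q {ω | u < W ω} * Q {ω | v < Z ω}) :
    ∫ ω, Real.log (W ω) * Real.log (Z ω) ∂Q ≤
      (∫ ω, Real.log (W ω) ∂Q) * ∫ ω, Real.log (Z ω) ∂Q := by
  have hWI := hWL.integrable one_le_two
  have hZI := hZL.integrable one_le_two
  have hWZI : Integrable (fun ω => Real.log (W ω) * Real.log (Z ω)) Q := hWL.integrable_mul hZL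
  have hlogW : ∀ᵐ ω ∂Q, 0 ≤ -Real.log (W ω) := by
    filter_upwards [hW0] with ω hω
    have := Real.log_nonpos hω.le (hW1 ω)
    linarith
  have hlogZ : ∀ᵐ ω ∂Q, 0 ≤ -Real.log (Z ω) := by
    filter_upwards [hZ0] with ω hω
    have := Real.log_nonpos hω.le (hZ1 ω)
    linarith
  have hset : ∀ {V : Ω → ℝ}, (∀ᵐ ω ∂Q, 0 < V ω) → ∀ s : ℝ,
      {ω | s ≤ -Real.log (V ω)} =ᵐ[Q] {ω | Real.exp (-s) < V ω}ᶜ := by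
    intro V hV s
    filter_upwards [hV] with ω hω
    refine propext ?_
    change s ≤ -Real.log (V ω) ↔ ¬ Real.exp (-s) < V ω
    rw [not_lt, ← Real.log_le_iff_le_exp hω]
    constructor <;> intro <;> linarith
  have key := lintegral_mul_le_of_tail_le (Q := Q) (G := fun ω => -Real.log (W ω))
    (K := fun ω => -Real.log (Z ω)) (Real.measurable_log.comp hW).neg
    (Real.measurable_log.comp hZ).neg hlogW hlogZ ?_
  · have h1 : ∫⁻ ω, ENNReal.ofReal (-Real.log (W ω)) * ENNReal.ofReal (-Real.log (Z ω)) ∂Q =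
        ENNReal.ofReal (∫ ω, Real.log (W ω) * Real.log (Z ω) ∂Q) := by
      rw [ofReal_integral_eq_lintegral_ofReal hWZI]
      · refine lintegral_congr_ae ?_
        filter_upwards [hlogW] with ω h1
        rw [← ENNReal.ofReal_mul h1, neg_mul_neg]
      · filter_upwards [hlogW, hlogZ] with ω h1 h2
        rw [← neg_mul_neg]
        exact mul_nonneg h1 h2
    have hWI' : Integrable (fun ω => -Real.log (W ω)) Q := hWI.neg
    have hZI' : Integrable (fun ω => -Real.log (Z ω)) Q := hZI.neg
    rw [h1, ← ofReal_integral_eq_lintegral_ofReal hWI' hlogW,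
      ← ofReal_integral_eq_lintegral_ofReal hZI' hlogZ,
      ← ENNReal.ofReal_mul (integral_nonneg_of_ae hlogW),
      ENNReal.ofReal_le_ofReal_iff (mul_nonneg (integral_nonneg_of_ae hlogW)
        (integral_nonneg_of_ae hlogZ))] at key
    simpa [integral_neg] using key
  · intro s hs t ht
    rw [measure_congr ((hset hW0 s).inter (hset hZ0 t)), measure_congr (hset hW0 s),
      measure_congr (hset hZ0 t)]
    set A := {ω | Real.exp (-s) < W ω}
    set B := {ω | Real.exp (-t) < Z ω}
    have hA : MeasurableSet A := measurableSet_lt measurable_const hW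
    have hB : MeasurableSet B := measurableSet_lt measurable_const hZ
    have hAB : Q.real (A ∩ B) ≤ Q.real A * Q.real B := by
      have := ENNReal.toReal_mono (ENNReal.mul_ne_top (measure_ne_top _ _) (measure_ne_top _ _))
        (h (Real.exp (-s)) ⟨Real.exp_pos _, by simpa using hs⟩
          (Real.exp (-t)) ⟨Real.exp_pos _, by simpa using ht⟩)
      rwa [ENNReal.toReal_mul] at this
    -- By inclusion and exclusion, 1 - Q(A) - Q(B) + Q(A ∩ B) ≤ (1 - Q(A))(1 - Q(B)).
    have hcompl : Q (A ∪ B)ᶜ ≤ Q Aᶜ * Q Bᶜ := by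
      rw [← ENNReal.toReal_le_toReal (measure_ne_top _ _)
        (ENNReal.mul_ne_top (measure_ne_top _ _) (measure_ne_top _ _)), ENNReal.toReal_mul]
      change Q.real _ ≤ Q.real _ * Q.real _
      rw [probReal_compl_eq_one_sub (hA.union hB), probReal_compl_eq_one_sub hA,
        probReal_compl_eq_one_sub hB]
      have := measureReal_union_add_inter (μ := Q) (s := A) hB
      linarith
    rw [Set.compl_union] at hcompl
    exact hcompl

end NegativeDependence

/-! ### The distance to the nearest of finitely many independent points. -/

section MinDist

variable {ι E : Type*} [Fintype ι] [Nonempty ι] [NormedAddCommGroup E]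

/-- The distance from `x` to the nearest point of the finite family `z`. -/
def minDist (x : E) (z : ι → E) : ℝ := ⨅ j, dist x (z j)

lemma exists_dist_eq_minDist (x : E) (z : ι → E) : ∃ j, dist x (z j) = minDist x z :=
  exists_eq_ciInf_of_finite

lemma minDist_le (x : E) (z : ι → E) (j : ι) : minDist x z ≤ dist x (z j) :=
  ciInf_le (Set.finite_range _).bddBelow j

lemma lt_minDist_iff {x : E} {z : ι → E} {r : ℝ} : r < minDist x z ↔ ∀ j, r < dist x (z j) := by
  refine ⟨fun h j => h.trans_le (minDist_le x z j), fun h => ?_⟩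
  obtain ⟨j, hj⟩ := exists_dist_eq_minDist x z
  exact hj ▸ h j

lemma measurable_minDist [MeasurableSpace E] [BorelSpace E] [SecondCountableTopology E] :
    Measurable fun p : E × (ι → E) => minDist p.1 p.2 :=
  Measurable.iInf fun j => by fun_prop

variable [MeasurableSpace E] [BorelSpace E] {μ : Measure E} [IsProbabilityMeasure μ]

lemma pi_lt_minDist (x : E) (r : ℝ) :
    Measure.pi (fun _ : ι => μ) {z | r < minDist x z} =
      ENNReal.ofReal ((1 - μ.real (Metric.closedBall x r)) ^ Fintype.card ι) := by
  have hset : {z : ι → E | r < minDist x z} =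
      Set.univ.pi fun _ : ι => (Metric.closedBall x r)ᶜ := by
    ext z
    simp [lt_minDist_iff, dist_comm x]
  rw [hset, Measure.pi_pi, Finset.prod_const, Finset.card_univ,
    prob_compl_eq_one_sub Metric.isClosed_closedBall.measurableSet,
    ENNReal.ofReal_pow (by linarith [measureReal_le_one (μ := μ) (s := Metric.closedBall x r)]),
    ENNReal.ofReal_sub _ measureReal_nonneg, ENNReal.ofReal_one, ofReal_measureReal]

/-- The two balls are disjoint, so each independent point misses both with probability 1 - a - b ≤
(1-a)(1-b), where a and b are the ball probabilities; then take powers. This is the source of all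
negative dependence in the proof. -/
lemma pi_lt_minDist_inter_le (x y : E) (r s : ℝ) (hrs : r + s < dist x y) :
    Measure.pi (fun _ : ι => μ) ({z | r < minDist x z} ∩ {z | s < minDist y z}) ≤
      Measure.pi (fun _ : ι => μ) {z | r < minDist x z} *
        Measure.pi (fun _ : ι => μ) {z | s < minDist y z} := by
  have hset : {z : ι → E | r < minDist x z} ∩ {z | s < minDist y z} =
      Set.univ.pi fun _ : ι => (Metric.closedBall x r ∪ Metric.closedBall y s)ᶜ := by
    ext z
    simp [lt_minDist_iff, dist_comm x, dist_comm y, forall_and]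
  have h1 := measureReal_le_one (μ := μ) (s := Metric.closedBall x r)
  have h2 := measureReal_le_one (μ := μ) (s := Metric.closedBall y s)
  have h0 := measureReal_le_one (μ := μ) (s := Metric.closedBall x r ∪ Metric.closedBall y s)
  have hmr : MeasurableSet (Metric.closedBall x r) := Metric.isClosed_closedBall.measurableSet
  have hms : MeasurableSet (Metric.closedBall y s) := Metric.isClosed_closedBall.measurableSet
  rw [pi_lt_minDist, pi_lt_minDist, hset, Measure.pi_pi, Finset.prod_const, Finset.card_univ,
    ← ofReal_measureReal, probReal_compl_eq_one_sub (hmr.union hms),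
    ← ENNReal.ofReal_pow (by linarith), ← ENNReal.ofReal_mul (by bound), ← mul_pow]
  refine ENNReal.ofReal_le_ofReal (pow_le_pow_left₀ (by linarith) ?_ _)
  rw [measureReal_union (Metric.closedBall_disjoint_closedBall hrs) hms]
  nlinarith [measureReal_nonneg (μ := μ) (s := Metric.closedBall x r),
    measureReal_nonneg (μ := μ) (s := Metric.closedBall y s)]

end MinDist

/-! ### Inequalities and dominated convergence for second moments. -/

section L2

variable {Ω : Type*} [MeasurableSpace Ω] {P : Measure Ω}

lemma sq_integral_le_integral_sq [IsProbabilityMeasure P] {g : Ω → ℝ} (hg : MemLp g 2 P) :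
    (∫ ω, g ω ∂P) ^ 2 ≤ ∫ ω, g ω ^ 2 ∂P := by
  have h := variance_nonneg g P
  rw [variance_eq_sub hg] at h
  simpa using h

lemma integral_mul_le_sqrt_mul_sqrt {a b : Ω → ℝ} (ha : MemLp a 2 P) (hb : MemLp b 2 P) :
    ∫ ω, a ω * b ω ∂P ≤ √(∫ ω, a ω ^ 2 ∂P) * √(∫ ω, b ω ^ 2 ∂P) := by
  have h := integral_mul_norm_le_Lp_mul_Lq (μ := P) (f := a) (g := b) (p := 2) (q := 2)
    (by rw [Real.holderConjugate_iff]; norm_num) (by simpa using ha) (by simpa using hb)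
  have h1 : ∫ ω, a ω * b ω ∂P ≤ ∫ ω, ‖a ω‖ * ‖b ω‖ ∂P := by
    refine integral_mono (ha.integrable_mul hb) (ha.norm.integrable_mul hb.norm) fun ω => ?_
    simp only [← norm_mul]
    exact Real.le_norm_self _
  refine h1.trans (h.trans_eq ?_)
  simp [Real.sqrt_eq_rpow]

lemma integral_add_sq_le {a b : Ω → ℝ} (ha : MemLp a 2 P) (hb : MemLp b 2 P) :
    ∫ ω, (a ω + b ω) ^ 2 ∂P ≤ 2 * ∫ ω, a ω ^ 2 ∂P + 2 * ∫ ω, b ω ^ 2 ∂P := by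
  rw [← integral_const_mul, ← integral_const_mul, ← integral_add (ha.integrable_sq.const_mul 2)
    (hb.integrable_sq.const_mul 2)]
  refine integral_mono (ha.add hb).integrable_sq
    ((ha.integrable_sq.const_mul 2).add (hb.integrable_sq.const_mul 2)) fun ω => ?_
  change (a ω + b ω) ^ 2 ≤ 2 * a ω ^ 2 + 2 * b ω ^ 2
  nlinarith [sq_nonneg (a ω - b ω)]

lemma integral_const_add_mul_const_add [IsProbabilityMeasure P] {a b : Ω → ℝ} (ha : MemLp a 2 P)
    (hb : MemLp b 2 P) (k : ℝ) :
    ∫ ω, (k + a ω) * (k + b ω) ∂P =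
      k ^ 2 + k * (∫ ω, a ω ∂P) + k * (∫ ω, b ω ∂P) + ∫ ω, a ω * b ω ∂P := by
  have hIa : Integrable (fun ω => k * a ω) P := (ha.integrable one_le_two).const_mul k
  have hIb : Integrable (fun ω => k * b ω) P := (hb.integrable one_le_two).const_mul k
  have hIab : Integrable (fun ω => a ω * b ω) P := ha.integrable_mul hb
  have hI1 : Integrable (fun ω => k ^ 2 + k * a ω) P := (integrable_const _).add hIa
  have hI2 : Integrable (fun ω => k ^ 2 + k * a ω + k * b ω) P := hI1.add hIb
  calc ∫ ω, (k + a ω) * (k + b ω) ∂P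
      = ∫ ω, (k ^ 2 + k * a ω + k * b ω + a ω * b ω) ∂P := by
        congr 1; funext ω; ring
    _ = _ := by
        rw [integral_add hI2 hIab, integral_add hI1 hIb, integral_add (integrable_const _) hIa,
          integral_const_mul, integral_const_mul]
        simp

lemma tendsto_integral_sq_of_dominated {g : ℕ → Ω → ℝ} {G : Ω → ℝ} (hG : MemLp G 2 P)
    (hm : ∀ n, AEStronglyMeasurable (g n) P) (hb : ∀ n, ∀ᵐ ω ∂P, |g n ω| ≤ G ω)
    (hlim : ∀ᵐ ω ∂P, Tendsto (fun n => g n ω) atTop (𝓝 0)) :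
    Tendsto (fun n => ∫ ω, g n ω ^ 2 ∂P) atTop (𝓝 0) := by
  have := tendsto_integral_of_dominated_convergence (μ := P) (F := fun n ω => g n ω ^ 2)
    (f := fun _ => 0) (fun ω => G ω ^ 2) (fun n => (hm n).pow 2) hG.integrable_sq
    (fun n => by
      filter_upwards [hb n] with ω hω
      rw [norm_pow, Real.norm_eq_abs]
      gcongr)
    (by
      filter_upwards [hlim] with ω hω
      simpa using hω.pow 2)
  simpa using this

end L2

/-! ### Ball probabilities given one or two fixed centres. -/

section Conditional

variable {E : Type*} [NormedAddCommGroup E] [InnerProductSpace ℝ E] [FiniteDimensional ℝ E]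
  [MeasurableSpace E] [BorelSpace E] [Nontrivial E]
  {ι : Type*} [Fintype ι] [Nonempty ι]

variable (μ : Measure E)

/-- The logarithm of the probability of the ball around `x` reaching to the nearest point of
the family `z`. -/
def logNearestProb (x : E) (z : ι → E) : ℝ :=
  Real.log (μ.real (Metric.closedBall x (minDist x z)))

/-- The variant of `logNearestProb` in which the radius is truncated at half the distance
from `x` to `y`. -/
def logTruncatedProb (x y : E) (z : ι → E) : ℝ :=
  Real.log (μ.real (Metric.closedBall x (min (minDist x z) (dist x y / 2))))

variable {μ} [IsProbabilityMeasure μ] {f : E → ℝ}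

lemma measurable_logNearestProb :
    Measurable fun p : E × (ι → E) => logNearestProb μ p.1 p.2 :=
  Real.measurable_log.comp (measurable_ballProb.comp (measurable_fst.prodMk measurable_minDist))

lemma measurable_logTruncatedProb :
    Measurable fun p : E × E × (ι → E) => logTruncatedProb μ p.1 p.2.1 p.2.2 := by
  refine Real.measurable_log.comp (measurable_ballProb.comp (measurable_fst.prodMk
    (Measurable.min ?_ (by fun_prop))))
  exact measurable_minDist.comp (by fun_prop : Measurable
    fun p : E × E × (ι → E) => (p.1, p.2.2))

namespace HasLogQuadraticDensity

lemma pi_lt_ballProb_minDist (h : HasLogQuadraticDensity μ f) (x : E) {u : ℝ}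
    (hu : u ∈ Set.Ioo (0 : ℝ) 1) :
    Measure.pi (fun _ : ι => μ) {z | u < μ.real (Metric.closedBall x (minDist x z))} =
      ENNReal.ofReal ((1 - u) ^ Fintype.card ι) := by
  obtain ⟨r, -, hru, hr⟩ := h.exists_ballProb_eq x hu
  simp_rw [hr, pi_lt_minDist, hru]

/-- If the radius at which the ball has probability u or v reaches half the distance of the centres,
truncation makes the corresponding event empty. Otherwise the two radii sum to less than the
distance and the balls are disjoint. -/
lemma pi_lt_ballProb_trunc_inter_le (h : HasLogQuadraticDensity μ f) (x y : E) {u v : ℝ}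
    (hu : u ∈ Set.Ioo (0 : ℝ) 1) (hv : v ∈ Set.Ioo (0 : ℝ) 1) :
    Measure.pi (fun _ : ι => μ)
        ({z | u < μ.real (Metric.closedBall x (min (minDist x z) (dist x y / 2)))} ∩
          {z | v < μ.real (Metric.closedBall y (min (minDist y z) (dist y x / 2)))}) ≤
      Measure.pi (fun _ : ι => μ)
          {z | u < μ.real (Metric.closedBall x (min (minDist x z) (dist x y / 2)))} *
        Measure.pi (fun _ : ι => μ)
          {z | v < μ.real (Metric.closedBall y (min (minDist y z) (dist y x / 2)))} := by
  obtain ⟨r, -, -, hr⟩ := h.exists_ballProb_eq x hu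
  obtain ⟨s, -, -, hs⟩ := h.exists_ballProb_eq y hv
  simp_rw [hr, hs, lt_min_iff]
  by_cases h1 : r < dist x y / 2
  · by_cases h2 : s < dist y x / 2
    · simp only [h1, h2, and_true]
      refine pi_lt_minDist_inter_le x y r s ?_
      rw [dist_comm y x] at h2
      linarith
    · simp [h2]
  · simp [h1]

lemma measurable_ballProb_minDist (x : E) :
    Measurable fun z : ι → E => μ.real (Metric.closedBall x (minDist x z)) :=
  measurable_ballProb.comp (measurable_const.prodMk
    (measurable_minDist.comp (measurable_const.prodMk measurable_id)))

lemma ae_minDist_pos (h : HasLogQuadraticDensity μ f) (x : E) :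
    ∀ᵐ z ∂(Measure.pi fun _ : ι => μ), 0 < minDist x z := by
  filter_upwards [ae_pos_of_minUniform_tail (fun u hu => h.pi_lt_ballProb_minDist (ι := ι) x hu)
    (measurable_ballProb_minDist x)] with z hz
  exact (h.ballProb_pos_iff x).1 hz

lemma memLp_logNearestProb (h : HasLogQuadraticDensity μ f) (x : E) :
    MemLp (fun z : ι → E => logNearestProb μ x z) 2 (Measure.pi fun _ => μ) :=
  memLp_log_of_minUniform_tail Fintype.card_pos (measurable_ballProb_minDist x)
    (fun _ => measureReal_le_one) fun _ hu => h.pi_lt_ballProb_minDist x hu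

lemma integral_logNearestProb (h : HasLogQuadraticDensity μ f) (x : E) :
    ∫ z, logNearestProb μ x z ∂(Measure.pi fun _ : ι => μ) = -(harmonic (Fintype.card ι) : ℝ) :=
  integral_log_of_minUniform_tail Fintype.card_pos (measurable_ballProb_minDist x)
    (fun _ => measureReal_le_one) fun _ hu => h.pi_lt_ballProb_minDist x hu

lemma logTruncatedProb_eq (h : HasLogQuadraticDensity μ f) {x y : E} {z : ι → E}
    (hxy : x ≠ y) (hz : 0 < minDist x z) :
    logTruncatedProb μ x y z =
      min (logNearestProb μ x z) (Real.log (μ.real (Metric.closedBall x (dist x y / 2)))) := by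
  have hτ : 0 < dist x y / 2 := half_pos (dist_pos.2 hxy)
  have hp := (h.ballProb_pos_iff x).2 hz
  have hq := (h.ballProb_pos_iff x).2 hτ
  rw [logTruncatedProb, logNearestProb]
  rcases le_total (minDist x z) (dist x y / 2) with h1 | h1
  · rw [min_eq_left h1, min_eq_left]
    exact Real.log_le_log hp (measureReal_mono (Metric.closedBall_subset_closedBall h1))
  · rw [min_eq_right h1, min_eq_right]
    exact Real.log_le_log hq (measureReal_mono (Metric.closedBall_subset_closedBall h1))

lemma memLp_logTruncatedProb (h : HasLogQuadraticDensity μ f) {x y : E} (hxy : x ≠ y) :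
    MemLp (fun z : ι → E => logTruncatedProb μ x y z) 2 (Measure.pi fun _ => μ) := by
  have hm : Measurable fun z : ι → E => logTruncatedProb μ x y z :=
    measurable_logTruncatedProb.comp (measurable_const.prodMk
      (measurable_const.prodMk measurable_id))
  refine MemLp.mono ((h.memLp_logNearestProb x).norm.add (memLp_const
    |Real.log (μ.real (Metric.closedBall x (dist x y / 2)))|)) hm.aestronglyMeasurable ?_
  filter_upwards [h.ae_minDist_pos x] with z hz
  rw [h.logTruncatedProb_eq hxy hz]
  simp only [Pi.add_apply, Real.norm_eq_abs]
  refine abs_min_le_max_abs_abs.trans ((max_le ?_ ?_).trans (le_abs_self _))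
  · linarith [abs_nonneg (Real.log (μ.real (Metric.closedBall x (dist x y / 2))))]
  · linarith [abs_nonneg (logNearestProb μ x z)]

/-- Given the two centres, the truncated logarithmic ball probabilities around them are
negatively correlated. -/
lemma integral_logTruncatedProb_mul_le (h : HasLogQuadraticDensity μ f) {x y : E} (hxy : x ≠ y)
    (k : ℝ) :
    ∫ z, (k + logTruncatedProb μ x y z) * (k + logTruncatedProb μ y x z)
        ∂(Measure.pi fun _ : ι => μ) ≤
      2 * (k - harmonic (Fintype.card ι)) ^ 2 +
        ∫ z, ((logTruncatedProb μ x y z - logNearestProb μ x z) ^ 2 +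
          (logTruncatedProb μ y x z - logNearestProb μ y z) ^ 2)
          ∂(Measure.pi fun _ : ι => μ) := by
  set Q := Measure.pi fun _ : ι => μ
  set c := k - (harmonic (Fintype.card ι) : ℝ) with hc
  -- The untruncated mean is exactly -`harmonic`, so k plus the truncated mean differs from c only
  -- by the mean truncation gap, whose square is at most the mean squared gap.
  have mean : ∀ {a b : E}, a ≠ b → (∫ z, logTruncatedProb μ a b z ∂Q + k) ^ 2 ≤
      2 * c ^ 2 + 2 * ∫ z, (logTruncatedProb μ a b z - logNearestProb μ a z) ^ 2 ∂Q := by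
    intro a b hab
    have hT := h.memLp_logTruncatedProb (ι := ι) hab
    have hS := h.memLp_logNearestProb (ι := ι) a
    have h1 := sq_integral_le_integral_sq (hT.sub hS)
    simp only [Pi.sub_apply] at h1
    rw [integral_sub (hT.integrable one_le_two) (hS.integrable one_le_two),
      h.integral_logNearestProb] at h1
    set t := ∫ z, logTruncatedProb μ a b z ∂Q
    have : t + k = (t - -(harmonic (Fintype.card ι) : ℝ)) + c := by rw [hc]; ring
    rw [this]
    nlinarith [sq_nonneg ((t - -(harmonic (Fintype.card ι) : ℝ)) - c)]
  have hTx := h.memLp_logTruncatedProb (ι := ι) hxy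
  have hTy := h.memLp_logTruncatedProb (ι := ι) hxy.symm
  have hSx := h.memLp_logNearestProb (ι := ι) x
  have hSy := h.memLp_logNearestProb (ι := ι) y
  have pos : ∀ {a b : E}, a ≠ b →
      ∀ᵐ z ∂Q, 0 < μ.real (Metric.closedBall a (min (minDist a z) (dist a b / 2))) := by
    intro a b hab
    filter_upwards [h.ae_minDist_pos a] with z hz
    exact (h.ballProb_pos_iff a).2 (lt_min hz (half_pos (dist_pos.2 hab)))
  have meas : ∀ a b : E, Measurable fun z : ι → E =>
      μ.real (Metric.closedBall a (min (minDist a z) (dist a b / 2))) := fun a b =>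
    measurable_ballProb.comp (measurable_const.prodMk ((measurable_minDist.comp
      (measurable_const.prodMk measurable_id)).min measurable_const))
  have hcov : ∫ z, logTruncatedProb μ x y z * logTruncatedProb μ y x z ∂Q ≤
      (∫ z, logTruncatedProb μ x y z ∂Q) * ∫ z, logTruncatedProb μ y x z ∂Q :=
    integral_log_mul_log_le (meas x y) (meas y x) (fun _ => measureReal_le_one)
      (fun _ => measureReal_le_one) (pos hxy) (pos hxy.symm) hTx hTy
      fun u hu v hv => h.pi_lt_ballProb_trunc_inter_le x y hu hv
  have hx := mean hxy
  have hy := mean hxy.symm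
  have hIx : Integrable (fun z => (logTruncatedProb μ x y z - logNearestProb μ x z) ^ 2) Q :=
    (hTx.sub hSx).integrable_sq
  have hIy : Integrable (fun z => (logTruncatedProb μ y x z - logNearestProb μ y z) ^ 2) Q :=
    (hTy.sub hSy).integrable_sq
  rw [integral_add hIx hIy, integral_const_add_mul_const_add hTx hTy]
  set a := ∫ z, logTruncatedProb μ x y z ∂Q
  set b := ∫ z, logTruncatedProb μ y x z ∂Q
  -- The covariance bound leaves (k+a)(k+b), which is at most half the sum of the squares; the
  -- factors 2 in `mean` then cancel the half.
  nlinarith [sq_nonneg ((a + k) - (b + k))]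

end HasLogQuadraticDensity

end Conditional

/-! ### Independent samples and the domination of the errors. -/

section Sample

/-- `X` is a sequence of independent random variables with common law `μ`. -/
structure IsIIDSequence {Ω E : Type*} [MeasurableSpace Ω] [MeasurableSpace E] (P : Measure Ω)
    (μ : Measure E) (X : ℕ → Ω → E) : Prop where
  measurable : ∀ i, Measurable (X i)
  map_eq : ∀ i, P.map (X i) = μ
  iIndepFun : iIndepFun X P

namespace IsIIDSequence

variable {Ω E : Type*} [MeasurableSpace Ω] [MeasurableSpace E] {P : Measure Ω}
    {μ : Measure E} [IsProbabilityMeasure μ] {X : ℕ → Ω → E}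

lemma comp_injective (h : IsIIDSequence P μ X) {σ : ℕ → ℕ} (hσ : σ.Injective) :
    IsIIDSequence P μ (X ∘ σ) :=
  ⟨fun _ => h.measurable _, fun _ => h.map_eq _, ProbabilityTheory.iIndepFun.precomp (g := σ) hσ h.iIndepFun⟩

lemma map_fin (h : IsIIDSequence P μ X) (n : ℕ) :
    P.map (fun ω (i : Fin n) => X i ω) = Measure.pi fun _ => μ := by
  have := (ProbabilityTheory.iIndepFun.precomp (Fin.val_injective (n := n)) h.iIndepFun).map_fun_eq_pi_map
    fun i => (h.measurable _).aemeasurable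
  simpa [Function.comp_def, h.map_eq] using this

lemma map_head_tail (h : IsIIDSequence P μ X) (n : ℕ) :
    P.map (fun ω => (X 0 ω, fun j : Fin n => X (j + 1) ω)) =
      μ.prod (Measure.pi fun _ => μ) := by
  have hp := measurePreserving_piFinSuccAbove (fun _ : Fin (n + 1) => μ) 0
  rw [← hp.map_eq, ← h.map_fin (n + 1), Measure.map_map hp.measurable
    (measurable_pi_lambda _ fun i => h.measurable _)]
  rfl

lemma map_pair_tail (h : IsIIDSequence P μ X) (n : ℕ) :
    P.map (fun ω => (X 0 ω, X 1 ω, fun j : Fin n => X (j + 2) ω)) =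
      μ.prod (μ.prod (Measure.pi fun _ => μ)) := by
  have hp := measurePreserving_piFinSuccAbove (fun _ : Fin (n + 1) => μ) 0
  have hq := (MeasurePreserving.id μ).prod hp
  rw [← hq.map_eq, ← h.map_head_tail (n + 1), Measure.map_map hq.measurable
    ((h.measurable _).prodMk (measurable_pi_lambda _ fun i => h.measurable _))]
  rfl

lemma map_head_tail_two (h : IsIIDSequence P μ X) (n : ℕ) :
    P.map (fun ω => (X 0 ω, fun j : Fin n => X (j + 2) ω)) =
      μ.prod (Measure.pi fun _ => μ) := by
  have hσ : Function.Injective fun k : ℕ => if k = 0 then 0 else k + 1 := by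
    intro a b hab
    grind
  simpa using (h.comp_injective hσ).map_head_tail n

/-- The second point is presented as a one-point family, so that the results on nearest neighbour
distances apply to the distance of two sample points. -/
lemma map_pair (h : IsIIDSequence P μ X) {i j : ℕ} (hij : i ≠ j) :
    P.map (fun ω => (X i ω, fun _ : Fin 1 => X j ω)) = μ.prod (Measure.pi fun _ => μ) := by
  have hσ : ∃ σ : ℕ → ℕ, σ.Injective ∧ σ 0 = i ∧ σ 1 = j := by
    -- For k ≥ 2 the value k + i + j exceeds both i and j, which keeps the map injective.
    refine ⟨fun k => if k = 0 then i else if k = 1 then j else k + i + j, fun a b hab => ?_, ?_, ?_⟩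
    · grind
    · simp
    · simp
  obtain ⟨σ, hσ, rfl, rfl⟩ := hσ
  simpa using (h.comp_injective hσ).map_head_tail 1

end IsIIDSequence

namespace HasLogQuadraticDensity

variable {E : Type*} [NormedAddCommGroup E] [InnerProductSpace ℝ E] [FiniteDimensional ℝ E]
  [MeasurableSpace E] [BorelSpace E] [Nontrivial E] {μ : Measure E} [IsProbabilityMeasure μ]
  {f : E → ℝ} {ι : Type*} [Fintype ι] [Nonempty ι] {Ω : Type*} [MeasurableSpace Ω] {P : Measure Ω}
  [IsProbabilityMeasure P] {x : Ω → E} {z : Ω → ι → E}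

/-- The conditional tail given the centre does not depend on the centre, so integrating over the
centre changes nothing. -/
lemma map_lt_ballProb_minDist (h : HasLogQuadraticDensity μ f) (hx : Measurable x)
    (hz : Measurable z) (hxz : P.map (fun ω => (x ω, z ω)) = μ.prod (Measure.pi fun _ => μ))
    {u : ℝ} (hu : u ∈ Set.Ioo (0 : ℝ) 1) :
    P {ω | u < μ.real (Metric.closedBall (x ω) (minDist (x ω) (z ω)))} =
      ENNReal.ofReal ((1 - u) ^ Fintype.card ι) := by
  have hs : MeasurableSet {p : E × (ι → E) |
      u < μ.real (Metric.closedBall p.1 (minDist p.1 p.2))} :=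
    measurableSet_lt measurable_const
      (measurable_ballProb.comp (measurable_fst.prodMk measurable_minDist))
  have h1 : P {ω | u < μ.real (Metric.closedBall (x ω) (minDist (x ω) (z ω)))} =
      P.map (fun ω => (x ω, z ω)) {p : E × (ι → E) |
        u < μ.real (Metric.closedBall p.1 (minDist p.1 p.2))} := by
    rw [Measure.map_apply (hx.prodMk hz) hs]
    rfl
  rw [h1, hxz, Measure.prod_apply hs]
  have h2 : ∀ a : E, Measure.pi (fun _ : ι => μ) (Prod.mk a ⁻¹' {p : E × (ι → E) |
      u < μ.real (Metric.closedBall p.1 (minDist p.1 p.2))}) =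
        ENNReal.ofReal ((1 - u) ^ Fintype.card ι) := fun a => h.pi_lt_ballProb_minDist a hu
  simp_rw [h2]
  simp

lemma measurable_ballProb_minDist_comp (hx : Measurable x) (hz : Measurable z) :
    Measurable fun ω => μ.real (Metric.closedBall (x ω) (minDist (x ω) (z ω))) :=
  measurable_ballProb.comp (hx.prodMk (measurable_minDist.comp (hx.prodMk hz)))

lemma ae_minDist_pos_comp (h : HasLogQuadraticDensity μ f) (hx : Measurable x)
    (hz : Measurable z) (hxz : P.map (fun ω => (x ω, z ω)) = μ.prod (Measure.pi fun _ => μ)) :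
    ∀ᵐ ω ∂P, 0 < minDist (x ω) (z ω) := by
  filter_upwards [ae_pos_of_minUniform_tail (fun u hu => h.map_lt_ballProb_minDist hx hz hxz hu)
    (measurable_ballProb_minDist_comp hx hz)] with ω hω
  exact (h.ballProb_pos_iff _).1 hω

lemma memLp_logNearestProb_comp (h : HasLogQuadraticDensity μ f) (hx : Measurable x)
    (hz : Measurable z) (hxz : P.map (fun ω => (x ω, z ω)) = μ.prod (Measure.pi fun _ => μ)) :
    MemLp (fun ω => logNearestProb μ (x ω) (z ω)) 2 P :=
  memLp_log_of_minUniform_tail Fintype.card_pos (measurable_ballProb_minDist_comp hx hz)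
    (fun _ => measureReal_le_one) fun _ hu => h.map_lt_ballProb_minDist hx hz hxz hu

lemma integral_log_card_add_logNearestProb_sq_le (h : HasLogQuadraticDensity μ f)
    (hx : Measurable x) (hz : Measurable z)
    (hxz : P.map (fun ω => (x ω, z ω)) = μ.prod (Measure.pi fun _ => μ)) :
    ∫ ω, (Real.log ((Fintype.card ι : ℝ) + 1) + logNearestProb μ (x ω) (z ω)) ^ 2 ∂P ≤ 36 := by
  refine le_trans (le_of_eq (integral_congr_ae ?_)) (integral_log_mul_sq_le_of_minUniform_tail
    Fintype.card_pos (measurable_ballProb_minDist_comp hx hz)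
    (fun _ => measureReal_le_one) fun _ hu => h.map_lt_ballProb_minDist hx hz hxz hu)
  filter_upwards [h.ae_minDist_pos_comp hx hz hxz] with ω hω
  rw [Real.log_mul (by positivity) ((h.ballProb_pos_iff _).2 hω).ne', logNearestProb]

/-- The error made when the truncated ball probability is replaced by the density times the
volume of the ball reaching to the nearest point of `y` and the family `z`. -/
def truncationError (μ : Measure E) (f : E → ℝ) (x y : E) (z : ι → E) : ℝ :=
  Real.log (volume.real (Metric.closedBall x (min (minDist x z) (dist x y)))) +
    Real.log (f x) - logTruncatedProb μ x y z

lemma measurable_log_volume_closedBall :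
    Measurable fun p : E × ℝ => Real.log (volume.real (Metric.closedBall p.1 p.2)) :=
  Real.measurable_log.comp measurable_ballProb

lemma measurable_truncationError (h : HasLogQuadraticDensity μ f) :
    Measurable fun p : E × E × (ι → E) => truncationError μ f p.1 p.2.1 p.2.2 := by
  refine ((measurable_log_volume_closedBall.comp (measurable_fst.prodMk (Measurable.min
    (measurable_minDist.comp (by fun_prop : Measurable
      fun p : E × E × (ι → E) => (p.1, p.2.2))) (by fun_prop)))).add
      (h.continuous_log.measurable.comp measurable_fst)).sub measurable_logTruncatedProb

/-- A bound for the errors that does not depend on the family of further points. -/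
lemma exists_error_bound (h : HasLogQuadraticDensity μ f) :
    ∃ C : ℝ, 0 ≤ C ∧ ∀ x y : E, x ≠ y →
      |Real.log (μ.real (Metric.closedBall x (dist x y / 2)))| ≤
        C * (1 + ‖x‖ ^ 2 + ‖y‖ ^ 2 + |Real.log (dist x y)|) ∧
      |Real.log (dist x y)| ≤ C * (1 + ‖x‖ ^ 2 + ‖y‖ ^ 2 +
        |Real.log (μ.real (Metric.closedBall x (dist x y)))|) ∧
      ∀ {ι : Type} [Fintype ι] [Nonempty ι] (z : ι → E), 0 < minDist x z →
        |logTruncatedProb μ x y z - logNearestProb μ x z| ≤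
          C * (1 + ‖x‖ ^ 2 + ‖y‖ ^ 2 + |Real.log (dist x y)|) ∧
        |truncationError μ f x y z| ≤
          C * (1 + ‖x‖ ^ 2 + ‖y‖ ^ 2 + |Real.log (dist x y)|) := by
  obtain ⟨K, hK0, hKf, hKp⟩ := h.exists_abs_log_ballProb_le
  set D : ℝ := ((Module.finrank ℝ E : ℕ) : ℝ) with hD
  have hD1 : 1 ≤ D := by
    rw [hD]
    exact_mod_cast Module.finrank_pos (R := ℝ) (M := E)
  set V := |Real.log (volume.real (Metric.closedBall (0 : E) 1))| with hV
  have hV0 : 0 ≤ V := abs_nonneg _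
  -- D and V come from the logarithm of the volume of a ball. The errors 3Kq (ball against volume,
  -- used up to twice) and Kq (for log f) add up to at most 7Kq; `hbig` collects everything.
  refine ⟨D + V + 8 * K, by linarith, fun x y hxy => ?_⟩
  set q := 1 + ‖x‖ ^ 2 + ‖y‖ ^ 2 with hq
  set ℓ := |Real.log (dist x y)| with hℓ
  have hℓ0 : 0 ≤ ℓ := abs_nonneg _
  have hr : 0 < dist x y := dist_pos.2 hxy
  have hq1 : 1 ≤ q := by nlinarith [sq_nonneg ‖x‖, sq_nonneg ‖y‖]
  have hrq : dist x y ^ 2 ≤ 2 * q - 2 := by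
    have h1 := dist_le_norm_add_norm x y
    have : dist x y ^ 2 ≤ (‖x‖ + ‖y‖) ^ 2 := by gcongr
    nlinarith [sq_nonneg (‖x‖ - ‖y‖)]
  have hxq : 1 + ‖x‖ ^ 2 ≤ q := by nlinarith [sq_nonneg ‖y‖]
  have hKr : ∀ r, 0 < r → r ≤ dist x y →
      |Real.log (μ.real (Metric.closedBall x r)) -
        Real.log (volume.real (Metric.closedBall x r))| ≤ 3 * K * q := by
    intro r hr0 hrd
    refine (hKp x r hr0).trans ?_
    have : r ^ 2 ≤ dist x y ^ 2 := by gcongr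
    nlinarith
  have hlv : ∀ r, 0 < r → Real.log (volume.real (Metric.closedBall x r)) =
      D * Real.log r + Real.log (volume.real (Metric.closedBall (0 : E) 1)) :=
    fun r hr0 => log_volume_closedBall x hr0
  have hlp0 : ∀ r, Real.log (μ.real (Metric.closedBall x r)) ≤ 0 :=
    fun r => Real.log_nonpos measureReal_nonneg measureReal_le_one
  have hmono : ∀ r s, 0 < r → r ≤ s → Real.log (μ.real (Metric.closedBall x r)) ≤
      Real.log (μ.real (Metric.closedBall x s)) := fun r s hr0 hrs =>
    Real.log_le_log ((h.ballProb_pos_iff x).2 hr0)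
      (measureReal_mono (Metric.closedBall_subset_closedBall hrs))
  have hτ : 0 < dist x y / 2 := half_pos hr
  set τ := dist x y / 2 with hτd
  have hτr : τ ≤ dist x y := by linarith
  have hlogτ : |Real.log τ| ≤ ℓ + 1 := by
    rw [hτd, Real.log_div hr.ne' two_ne_zero]
    refine (abs_sub _ _).trans ?_
    rw [abs_of_pos (Real.log_pos one_lt_two)]
    linarith [Real.log_two_lt_d9]
  have hDτ : |D * Real.log τ| ≤ D * (ℓ + 1) := by
    rw [abs_mul, abs_of_nonneg (by linarith : 0 ≤ D)]
    gcongr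
  have hτp : |Real.log (μ.real (Metric.closedBall x τ))| ≤ D * (ℓ + 1) + V + 3 * K * q := by
    have h1 := hKr τ hτ hτr
    rw [hlv τ hτ] at h1
    have h2 := neg_abs_le (Real.log (volume.real (Metric.closedBall (0 : E) 1)))
    have h3 := le_abs_self (Real.log (volume.real (Metric.closedBall (0 : E) 1)))
    rw [← hV] at h2 h3
    rw [abs_le] at h1 hDτ ⊢
    constructor <;> linarith [h1.1, h1.2, hDτ.1, hDτ.2]
  have hbig : D * (ℓ + 1) + V + 3 * K * q + 4 * K * q ≤ (D + V + 8 * K) * (q + ℓ) := by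
    nlinarith [mul_nonneg hV0 hℓ0, mul_nonneg hK0 hℓ0, mul_nonneg hV0 (sub_nonneg.2 hq1),
      mul_nonneg (by linarith : 0 ≤ D) (sub_nonneg.2 hq1), mul_nonneg hK0 (by linarith : 0 ≤ q)]
  have hKq : 0 ≤ K * q := mul_nonneg hK0 (by linarith)
  have hfq : |Real.log (f x)| ≤ K * q := (hKf x).trans (by gcongr)
  refine ⟨hτp.trans (by linarith), ?_, fun {ι} _ _ z hz => ?_⟩
  · have h1 := hKr _ hr le_rfl
    rw [hlv _ hr] at h1
    set p := Real.log (μ.real (Metric.closedBall x (dist x y)))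
    have h2 := neg_abs_le (Real.log (volume.real (Metric.closedBall (0 : E) 1)))
    have h3 := le_abs_self (Real.log (volume.real (Metric.closedBall (0 : E) 1)))
    rw [← hV] at h2 h3
    have h4 : |D * Real.log (dist x y)| ≤ |p| + 3 * K * q + V := by
      rw [abs_le] at h1 ⊢
      constructor <;> linarith [h1.1, h1.2, neg_abs_le p, le_abs_self p]
    rw [abs_mul, abs_of_nonneg (by linarith : 0 ≤ D), ← hℓ] at h4
    have h5 : ℓ ≤ D * ℓ := le_mul_of_one_le_left hℓ0 hD1
    have h6 := abs_nonneg p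
    nlinarith [mul_nonneg hV0 h6, mul_nonneg hK0 h6, mul_nonneg hV0 (sub_nonneg.2 hq1),
      mul_nonneg (by linarith : 0 ≤ D - 1) h6, mul_nonneg (by linarith : 0 ≤ D) (by linarith : 0 ≤ q)]
  · rcases le_total (minDist x z) τ with hc | hc
    · have hT : logTruncatedProb μ x y z = logNearestProb μ x z := by
        rw [logTruncatedProb, min_eq_left hc, logNearestProb]
      constructor
      · rw [hT, sub_self, abs_zero]
        have : 0 ≤ D * (ℓ + 1) := by positivity
        linarith
      · rw [truncationError, hT, logNearestProb, min_eq_left (hc.trans hτr)]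
        have h1 := hKr _ hz (hc.trans hτr)
        have : 0 ≤ D * (ℓ + 1) := by positivity
        refine le_trans ?_ hbig
        rw [abs_le] at h1 hfq ⊢
        constructor <;> linarith [h1.1, h1.2, hfq.1, hfq.2]
    -- When the truncation is active, every radius involved is at least τ, so the logarithms of all
    -- the ball probabilities lie between that of the ball of radius τ and 0. The bound `hτp` is
    -- therefore enough, however far the nearest point may be.
    · have hT : logTruncatedProb μ x y z = Real.log (μ.real (Metric.closedBall x τ)) := by
        rw [logTruncatedProb, min_eq_right hc]
      have hτn := hlp0 τ
      rw [abs_of_nonpos hτn] at hτp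
      constructor
      · refine le_trans ?_ hbig
        have h1 := hmono _ _ hτ hc
        have h2 := hlp0 (minDist x z)
        rw [hT, logNearestProb, abs_of_nonpos (by linarith)]
        linarith
      · refine le_trans ?_ hbig
        have hn : τ ≤ min (minDist x z) (dist x y) := le_min hc hτr
        have h1 := hmono _ _ hτ hn
        have h2 := hlp0 (min (minDist x z) (dist x y))
        have h3 := hKr _ (hτ.trans_le hn) (min_le_right _ _)
        rw [truncationError, hT]
        rw [abs_le] at h3 hfq ⊢
        constructor <;> linarith [h3.1, h3.2, hfq.1, hfq.2]

end HasLogQuadraticDensity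

end Sample

/-! ### The two errors tend to zero in mean square. -/

section Asymptotics

variable {E : Type*} [NormedAddCommGroup E] [InnerProductSpace ℝ E] [FiniteDimensional ℝ E]
  [MeasurableSpace E] [BorelSpace E] [Nontrivial E] {μ : Measure E} [IsProbabilityMeasure μ]
  {f : E → ℝ} {Ω : Type*} [MeasurableSpace Ω] {P : Measure Ω}
  [IsProbabilityMeasure P] {X : ℕ → Ω → E}

lemma minDist_of_unique {ι : Type*} [Fintype ι] [Unique ι] (x : E) (z : ι → E) :
    minDist x z = dist x (z default) := by
  obtain ⟨j, hj⟩ := exists_dist_eq_minDist x z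
  rw [← hj, Subsingleton.elim j default]

namespace IsIIDSequence

lemma ae_ne (hX : IsIIDSequence P μ X) (h : HasLogQuadraticDensity μ f) {i j : ℕ} (hij : i ≠ j) :
    ∀ᵐ ω ∂P, X i ω ≠ X j ω := by
  filter_upwards [h.ae_minDist_pos_comp (hX.measurable i)
    (measurable_pi_lambda _ fun _ => hX.measurable j) (hX.map_pair hij)] with ω hω
  rwa [minDist_of_unique, dist_pos] at hω

lemma memLp_norm_sq (hX : IsIIDSequence P μ X) (hμ : MemLp id 4 μ) (i : ℕ) :
    MemLp (fun ω => ‖X i ω‖ ^ 2) 2 P := by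
  have h1 : MemLp (X i) 4 P := by
    rw [← hX.map_eq i] at hμ
    exact (memLp_map_measure_iff hμ.aestronglyMeasurable (hX.measurable i).aemeasurable).1 hμ
  have h2 := h1.norm_rpow_div 2
  have h3 : (4 : ENNReal) / 2 = 2 := by
    rw [show (4 : ENNReal) = 2 * 2 by norm_num,
      ENNReal.mul_div_cancel_right two_ne_zero ENNReal.ofNat_ne_top]
  simpa [h3] using h2

/-- The logarithm of the distance is bounded by squared norms and the log-probability of the ball
reaching from one point to the other. That probability is uniform (the case of one further point),
and its logarithm is square integrable. -/
lemma memLp_log_dist (hX : IsIIDSequence P μ X) (h : HasLogQuadraticDensity μ f)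
    (hμ : MemLp id 4 μ) {i j : ℕ} (hij : i ≠ j) :
    MemLp (fun ω => Real.log (dist (X i ω) (X j ω))) 2 P := by
  obtain ⟨C, -, hC⟩ := h.exists_error_bound
  have hp := h.memLp_logNearestProb_comp (hX.measurable i)
    (measurable_pi_lambda _ fun _ => hX.measurable j) (hX.map_pair hij)
  have hmi := hX.measurable i
  have hmj := hX.measurable j
  have h1 : MemLp (fun _ : Ω => (1 : ℝ)) 2 P := memLp_const 1
  have h2 := (h1.add (hX.memLp_norm_sq hμ i)).add (hX.memLp_norm_sq hμ j)
  refine MemLp.mono ((h2.add hp.norm).const_mul C)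
    (Real.measurable_log.comp (hmi.dist hmj)).aestronglyMeasurable ?_
  filter_upwards [hX.ae_ne h hij] with ω hω
  refine (hC _ _ hω).2.1.trans ((le_abs_self _).trans_eq ?_)
  simp [logNearestProb, minDist_of_unique]

lemma memLp_error_bound (hX : IsIIDSequence P μ X) (h : HasLogQuadraticDensity μ f)
    (hμ : MemLp id 4 μ) (C : ℝ) :
    MemLp (fun ω => C * (1 + ‖X 0 ω‖ ^ 2 + ‖X 1 ω‖ ^ 2 +
      |Real.log (dist (X 0 ω) (X 1 ω))|)) 2 P := by
  have h1 : MemLp (fun _ : Ω => (1 : ℝ)) 2 P := memLp_const 1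
  have h2 := (h1.add (hX.memLp_norm_sq hμ 0)).add (hX.memLp_norm_sq hμ 1)
  have h3 := (h2.add (hX.memLp_log_dist h hμ zero_ne_one).norm).const_mul C
  exact h3

/-- The nearest neighbour distances tend to zero. -/
lemma ae_tendsto_minDist (hX : IsIIDSequence P μ X) (h : HasLogQuadraticDensity μ f) :
    ∀ᵐ ω ∂P, Tendsto (fun n => minDist (X 0 ω) fun j : Fin (n + 1) => X (j + 2) ω)
      atTop (𝓝 0) := by
  set W : ℕ → Ω → ℝ := fun n ω => μ.real (Metric.closedBall (X 0 ω)
    (minDist (X 0 ω) fun j : Fin (n + 1) => X (j + 2) ω)) with hW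
  -- The ball probability exceeds u for every n with probability at most (1-u)^(n+1), which tends to
  -- 0. The shift by 2 keeps u strictly between 0 and 1.
  have hnull : ∀ k : ℕ, ∀ᵐ ω ∂P, ∃ n, W n ω ≤ 1 / ((k : ℝ) + 2) := by
    intro k
    have hu : 1 / ((k : ℝ) + 2) ∈ Set.Ioo (0 : ℝ) 1 := by
      refine ⟨by positivity, ?_⟩
      rw [div_lt_one (by positivity)]
      linarith [k.cast_nonneg (α := ℝ)]
    set u := 1 / ((k : ℝ) + 2)
    have hle : ∀ n : ℕ, P {ω | ¬ ∃ n, W n ω ≤ u} ≤ ENNReal.ofReal ((1 - u) ^ (n + 1)) := by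
      intro n
      have := h.map_lt_ballProb_minDist (hX.measurable 0)
        (measurable_pi_lambda _ fun j : Fin (n + 1) => hX.measurable (j + 2))
        (hX.map_head_tail_two (n + 1)) hu
      rw [Fintype.card_fin] at this
      rw [← this]
      refine measure_mono fun ω hω => ?_
      simp only [Set.mem_ofPred_eq, not_exists, not_le] at hω
      exact hω n
    have hlim : Tendsto (fun n : ℕ => ENNReal.ofReal ((1 - u) ^ (n + 1))) atTop (𝓝 0) := by
      rw [← ENNReal.ofReal_zero]
      exact ENNReal.tendsto_ofReal ((tendsto_add_atTop_iff_nat 1).2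
        (tendsto_pow_atTop_nhds_zero_of_lt_one (by linarith [hu.2]) (by linarith [hu.1])))
    rw [ae_iff]
    exact le_antisymm (ge_of_tendsto' hlim hle) zero_le
  filter_upwards [ae_all_iff.2 hnull] with ω hω
  rw [Metric.tendsto_atTop]
  intro ε hε
  obtain ⟨k, hk⟩ := exists_nat_gt (1 / μ.real (Metric.closedBall (X 0 ω) ε))
  obtain ⟨n, hn⟩ := hω k
  have hp := (h.ballProb_pos_iff (X 0 ω)).2 hε
  have hlt : W n ω < μ.real (Metric.closedBall (X 0 ω) ε) := by
    refine hn.trans_lt ?_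
    rw [div_lt_comm₀ (by positivity) hp]
    linarith
  have hlt' : minDist (X 0 ω) (fun j : Fin (n + 1) => X (j + 2) ω) < ε := by
    by_contra! hge
    exact hlt.not_ge (measureReal_mono (Metric.closedBall_subset_closedBall hge))
  -- The nearest point at stage n is still in the family at every later stage m, so the distance
  -- stays below ε.
  refine ⟨n, fun m hm => ?_⟩
  obtain ⟨j, hj⟩ := exists_dist_eq_minDist (X 0 ω) fun j : Fin (n + 1) => X (j + 2) ω
  have h1 := minDist_le (X 0 ω) (fun j : Fin (m + 1) => X (j + 2) ω) ⟨j, by omega⟩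
  have h0 : 0 ≤ minDist (X 0 ω) (fun j : Fin (m + 1) => X (j + 2) ω) :=
    Real.iInf_nonneg fun _ => dist_nonneg
  rw [Real.dist_eq, sub_zero, abs_of_nonneg h0]
  exact (h1.trans_eq hj).trans_lt hlt'

variable (X) in
/-- The part of the sample other than the two first points. -/
def tailPoints (n : ℕ) (ω : Ω) : Fin (n + 1) → E := fun j => X (j + 2) ω

lemma measurable_tailPoints (hX : IsIIDSequence P μ X) (n : ℕ) : Measurable (tailPoints X n) :=
  measurable_pi_lambda _ fun _ => hX.measurable _

lemma measurable_triple (hX : IsIIDSequence P μ X) (n : ℕ) :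
    Measurable fun ω => (X 0 ω, X 1 ω, tailPoints X n ω) :=
  (hX.measurable 0).prodMk ((hX.measurable 1).prodMk (hX.measurable_tailPoints n))

variable (μ X) in
/-- The effect of truncating the radius on the logarithmic ball probability. -/
def truncationGap (n : ℕ) (ω : Ω) : ℝ :=
  logTruncatedProb μ (X 0 ω) (X 1 ω) (tailPoints X n ω) -
    logNearestProb μ (X 0 ω) (tailPoints X n ω)

lemma measurable_truncationGap (hX : IsIIDSequence P μ X) (n : ℕ) :
    Measurable (truncationGap μ X n) :=
  (measurable_logTruncatedProb.comp (hX.measurable_triple n)).sub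
    (measurable_logNearestProb.comp ((hX.measurable 0).prodMk (hX.measurable_tailPoints n)))

variable (μ f X) in
/-- The truncation error along the sample. -/
def sampleTruncationError (n : ℕ) (ω : Ω) : ℝ :=
  HasLogQuadraticDensity.truncationError μ f (X 0 ω) (X 1 ω) (tailPoints X n ω)

lemma measurable_sampleTruncationError (hX : IsIIDSequence P μ X)
    (h : HasLogQuadraticDensity μ f) (n : ℕ) :
    Measurable (sampleTruncationError μ f X n) := by
  have := (h.measurable_truncationError (ι := Fin (n + 1))).comp (hX.measurable_triple n)
  unfold sampleTruncationError
  exact this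

lemma ae_minDist_tail_pos (hX : IsIIDSequence P μ X) (h : HasLogQuadraticDensity μ f) (n : ℕ) :
    ∀ᵐ ω ∂P, 0 < minDist (X 0 ω) (tailPoints X n ω) :=
  h.ae_minDist_pos_comp (hX.measurable 0) (hX.measurable_tailPoints n)
    (hX.map_head_tail_two (n + 1))

/-- A single square integrable function serves both errors and all n, as dominated convergence
requires. -/
lemma exists_dominating (hX : IsIIDSequence P μ X) (h : HasLogQuadraticDensity μ f)
    (hμ : MemLp id 4 μ) : ∃ G : Ω → ℝ, MemLp G 2 P ∧ ∀ n,
      (∀ᵐ ω ∂P, |truncationGap μ X n ω| ≤ G ω) ∧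
        ∀ᵐ ω ∂P, |sampleTruncationError μ f X n ω| ≤ G ω := by
  obtain ⟨C, -, hC⟩ := h.exists_error_bound
  refine ⟨_, hX.memLp_error_bound h hμ C, fun n => ⟨?_, ?_⟩⟩
  · filter_upwards [hX.ae_ne h zero_ne_one, hX.ae_minDist_tail_pos h n] with ω h1 h2
    exact ((hC _ _ h1).2.2 _ h2).1
  · filter_upwards [hX.ae_ne h zero_ne_one, hX.ae_minDist_tail_pos h n] with ω h1 h2
    exact ((hC _ _ h1).2.2 _ h2).2

lemma memLp_truncationGap (hX : IsIIDSequence P μ X) (h : HasLogQuadraticDensity μ f)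
    (hμ : MemLp id 4 μ) (n : ℕ) : MemLp (truncationGap μ X n) 2 P := by
  obtain ⟨G, hG, hb⟩ := hX.exists_dominating h hμ
  refine hG.mono (measurable_truncationGap hX n).aestronglyMeasurable ?_
  filter_upwards [(hb n).1] with ω hω
  exact hω.trans (le_abs_self _)

lemma memLp_sampleTruncationError (hX : IsIIDSequence P μ X) (h : HasLogQuadraticDensity μ f)
    (hμ : MemLp id 4 μ) (n : ℕ) : MemLp (sampleTruncationError μ f X n) 2 P := by
  obtain ⟨G, hG, hb⟩ := hX.exists_dominating h hμ
  refine hG.mono (hX.measurable_sampleTruncationError h n).aestronglyMeasurable ?_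
  filter_upwards [(hb n).2] with ω hω
  exact hω.trans (le_abs_self _)

lemma ae_eventually_minDist_lt (hX : IsIIDSequence P μ X) (h : HasLogQuadraticDensity μ f) :
    ∀ᵐ ω ∂P, ∀ᶠ n in atTop, minDist (X 0 ω) (tailPoints X n ω) < dist (X 0 ω) (X 1 ω) / 2 := by
  filter_upwards [hX.ae_ne h zero_ne_one, hX.ae_tendsto_minDist h] with ω h1 h2
  exact h2.eventually (eventually_lt_nhds (half_pos (dist_pos.2 h1)))

/-- Almost surely the gap vanishes from some n on: the nearest neighbour distance falls below half
the fixed positive distance between the first two points. -/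
lemma tendsto_integral_truncationGap_sq (hX : IsIIDSequence P μ X)
    (h : HasLogQuadraticDensity μ f) (hμ : MemLp id 4 μ) :
    Tendsto (fun n => ∫ ω, truncationGap μ X n ω ^ 2 ∂P) atTop (𝓝 0) := by
  obtain ⟨G, hG, hb⟩ := hX.exists_dominating h hμ
  refine tendsto_integral_sq_of_dominated hG
    (fun n => (measurable_truncationGap hX n).aestronglyMeasurable) (fun n => (hb n).1) ?_
  filter_upwards [hX.ae_eventually_minDist_lt h] with ω hω
  refine tendsto_const_nhds.congr' ?_
  filter_upwards [hω] with n hn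
  rw [truncationGap, logTruncatedProb, logNearestProb, min_eq_left hn.le, sub_self]

lemma tendsto_integral_sampleTruncationError_sq (hX : IsIIDSequence P μ X)
    (h : HasLogQuadraticDensity μ f) (hμ : MemLp id 4 μ) :
    Tendsto (fun n => ∫ ω, sampleTruncationError μ f X n ω ^ 2 ∂P) atTop (𝓝 0) := by
  obtain ⟨G, hG, hb⟩ := hX.exists_dominating h hμ
  refine tendsto_integral_sq_of_dominated hG
    (fun n => (hX.measurable_sampleTruncationError h n).aestronglyMeasurable)
    (fun n => (hb n).2) ?_
  filter_upwards [hX.ae_eventually_minDist_lt h, hX.ae_tendsto_minDist h,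
    ae_all_iff.2 fun n => hX.ae_minDist_tail_pos h n] with ω hω hlim hpos
  -- Once neither minimum is active, the error is log f minus the logarithm of the ratio of
  -- probability to volume on a shrinking ball, and continuity of log f makes it vanish in the
  -- limit.
  have h1 := (h.tendsto_log_ballProb_sub (X 0 ω)).comp
    (tendsto_nhdsWithin_iff.2 ⟨hlim, Eventually.of_forall hpos⟩)
  have h2 := h1.const_sub (Real.log (f (X 0 ω)))
  rw [sub_self] at h2
  refine h2.congr' ?_
  filter_upwards [hω] with n hn
  have hn' : minDist (X 0 ω) (tailPoints X n ω) ≤ dist (X 0 ω) (X 1 ω) := by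
    linarith [dist_nonneg (x := X 0 ω) (y := X 1 ω)]
  rw [sampleTruncationError, HasLogQuadraticDensity.truncationError, logTruncatedProb,
    min_eq_left hn.le, min_eq_left hn']
  change _ - (Real.log (μ.real (Metric.closedBall (X 0 ω) (minDist (X 0 ω) (tailPoints X n ω)))) -
    Real.log (volume.real (Metric.closedBall (X 0 ω) (minDist (X 0 ω) (tailPoints X n ω))))) = _
  ring

end IsIIDSequence

end Asymptotics

/-! ### Second moment and cross moment of the local errors. -/

section Consistency

variable {E : Type*} [NormedAddCommGroup E] [InnerProductSpace ℝ E] [FiniteDimensional ℝ E]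
  [MeasurableSpace E] [BorelSpace E] [Nontrivial E] {μ : Measure E} [IsProbabilityMeasure μ]
  {f : E → ℝ} {Ω : Type*} [MeasurableSpace Ω] {P : Measure Ω}
  [IsProbabilityMeasure P] {X : ℕ → Ω → E}

/-- The conditional estimate is available only for distinct centres; points are null, so Fubini
ignores the diagonal. -/
lemma integral_prod_prod_le_of_forall_ne [NullSingletonClass μ] {F : Type*} [MeasurableSpace F]
    {κ : Measure F} [IsProbabilityMeasure κ] {φ : E × E × F → ℝ} {C : ℝ}
    (hφ : Integrable φ (μ.prod (μ.prod κ)))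
    (hC : ∀ x y, x ≠ y → ∫ z, φ (x, y, z) ∂κ ≤ C) :
    ∫ p, φ p ∂(μ.prod (μ.prod κ)) ≤ C := by
  rw [integral_prod _ hφ]
  have hx : ∀ᵐ x ∂μ, ∫ q, φ (x, q) ∂(μ.prod κ) ≤ C := by
    filter_upwards [hφ.prod_right_ae] with x hxI
    rw [integral_prod _ hxI]
    have hy : ∀ᵐ y ∂μ, ∫ z, φ (x, y, z) ∂κ ≤ C := by
      filter_upwards [compl_mem_ae_iff.2 (measure_singleton x)] with y hy
      exact hC x y fun hxy => hy hxy.symm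
    simpa using integral_mono_ae hxI.integral_prod_left (integrable_const C) hy
  simpa using integral_mono_ae hφ.integral_prod_left (integrable_const C) hx

namespace IsIIDSequence

/-- Statements about the second point are those about the first point for the swapped sequence,
which has the same tail points. -/
lemma swap_zero_one (hX : IsIIDSequence P μ X) : IsIIDSequence P μ (X ∘ Equiv.swap 0 1) :=
  hX.comp_injective (Equiv.injective _)

lemma tailPoints_swap (n : ℕ) (ω : Ω) :
    tailPoints (X ∘ Equiv.swap 0 1) n ω = tailPoints X n ω := by
  funext j
  simp only [tailPoints, Function.comp_apply]
  rw [Equiv.swap_apply_of_ne_of_ne (by omega) (by omega)]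

lemma memLp_logNearestProb_tail (hX : IsIIDSequence P μ X) (h : HasLogQuadraticDensity μ f)
    (n : ℕ) : MemLp (fun ω => logNearestProb μ (X 0 ω) (tailPoints X n ω)) 2 P :=
  h.memLp_logNearestProb_comp (hX.measurable 0) (hX.measurable_tailPoints n)
    (hX.map_head_tail_two (n + 1))

variable (μ X) in
/-- The logarithm of the truncated probability of the ball around the first point, along the
sample. -/
def sampleLogTruncatedProb (n : ℕ) (ω : Ω) : ℝ :=
  logTruncatedProb μ (X 0 ω) (X 1 ω) (tailPoints X n ω)

lemma memLp_sampleLogTruncatedProb (hX : IsIIDSequence P μ X) (h : HasLogQuadraticDensity μ f)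
    (hμ : MemLp id 4 μ) (n : ℕ) : MemLp (sampleLogTruncatedProb μ X n) 2 P := by
  have h1 := (hX.memLp_logNearestProb_tail h n).add (hX.memLp_truncationGap h hμ n)
  refine h1.ae_eq (Eventually.of_forall fun ω => ?_)
  simp [truncationGap, sampleLogTruncatedProb]

lemma sampleLogTruncatedProb_swap (n : ℕ) (ω : Ω) :
    sampleLogTruncatedProb μ (X ∘ Equiv.swap 0 1) n ω =
      logTruncatedProb μ (X 1 ω) (X 0 ω) (tailPoints X n ω) := by
  rw [sampleLogTruncatedProb, tailPoints_swap]
  simp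

lemma truncationGap_swap (n : ℕ) (ω : Ω) :
    truncationGap μ (X ∘ Equiv.swap 0 1) n ω =
      logTruncatedProb μ (X 1 ω) (X 0 ω) (tailPoints X n ω) -
        logNearestProb μ (X 1 ω) (tailPoints X n ω) := by
  rw [truncationGap, tailPoints_swap]
  simp

lemma integral_sampleLogTruncatedProb_mul_le (hX : IsIIDSequence P μ X)
    (h : HasLogQuadraticDensity μ f) (hμ : MemLp id 4 μ) (n : ℕ) (k : ℝ) :
    ∫ ω, (k + sampleLogTruncatedProb μ X n ω) *
        (k + sampleLogTruncatedProb μ (X ∘ Equiv.swap 0 1) n ω) ∂P ≤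
      2 * (k - (harmonic (n + 1) : ℝ)) ^ 2 + (∫ ω, truncationGap μ X n ω ^ 2 ∂P +
        ∫ ω, truncationGap μ (X ∘ Equiv.swap 0 1) n ω ^ 2 ∂P) := by
  have := h.noAtoms
  have hX' := hX.swap_zero_one
  set κ : Measure (Fin (n + 1) → E) := Measure.pi fun _ => μ
  set F : E × E × (Fin (n + 1) → E) → ℝ := fun p =>
    (k + logTruncatedProb μ p.1 p.2.1 p.2.2) * (k + logTruncatedProb μ p.2.1 p.1 p.2.2) with hF
  set g : E × E × (Fin (n + 1) → E) → ℝ := fun p =>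
    (logTruncatedProb μ p.1 p.2.1 p.2.2 - logNearestProb μ p.1 p.2.2) ^ 2 +
      (logTruncatedProb μ p.2.1 p.1 p.2.2 - logNearestProb μ p.2.1 p.2.2) ^ 2 with hg
  have hT1 := measurable_logTruncatedProb (μ := μ) (ι := Fin (n + 1))
  have hS := measurable_logNearestProb (μ := μ) (ι := Fin (n + 1))
  have hm2 : Measurable fun p : E × E × (Fin (n + 1) → E) => (p.2.1, p.1, p.2.2) := by fun_prop
  have hm3 : Measurable fun p : E × E × (Fin (n + 1) → E) => (p.1, p.2.2) := by fun_prop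
  have hm4 : Measurable fun p : E × E × (Fin (n + 1) → E) => (p.2.1, p.2.2) := by fun_prop
  have hT2 := hT1.comp hm2
  have hS1 := hS.comp hm3
  have hS2 := hS.comp hm4
  have hFm : Measurable F := (hT1.const_add k).mul (hT2.const_add k)
  have hgm : Measurable g := ((hT1.sub hS1).pow_const 2).add ((hT2.sub hS2).pow_const 2)
  have hmt := hX.measurable_triple n
  have hlaw : P.map (fun ω => (X 0 ω, X 1 ω, tailPoints X n ω)) = μ.prod (μ.prod κ) :=
    hX.map_pair_tail (n + 1)
  have hFP : ∫ ω, (k + sampleLogTruncatedProb μ X n ω) *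
      (k + sampleLogTruncatedProb μ (X ∘ Equiv.swap 0 1) n ω) ∂P =
        ∫ p, F p ∂(μ.prod (μ.prod κ)) := by
    rw [← hlaw, integral_map hmt.aemeasurable hFm.aestronglyMeasurable]
    simp_rw [sampleLogTruncatedProb_swap]
    rfl
  have hI1 := (hX.memLp_truncationGap h hμ n).integrable_sq
  have hI2 := (hX'.memLp_truncationGap h hμ n).integrable_sq
  have hgP : ∫ ω, truncationGap μ X n ω ^ 2 ∂P +
      ∫ ω, truncationGap μ (X ∘ Equiv.swap 0 1) n ω ^ 2 ∂P = ∫ p, g p ∂(μ.prod (μ.prod κ)) := by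
    rw [← integral_add hI1 hI2, ← hlaw, integral_map hmt.aemeasurable hgm.aestronglyMeasurable]
    simp_rw [truncationGap_swap]
    rfl
  have hFI : Integrable F (μ.prod (μ.prod κ)) := by
    rw [← hlaw, integrable_map_measure hFm.aestronglyMeasurable hmt.aemeasurable]
    have h1 := (memLp_const (μ := P) k).add (hX.memLp_sampleLogTruncatedProb h hμ n)
    have h2 := (memLp_const (μ := P) k).add (hX'.memLp_sampleLogTruncatedProb h hμ n)
    refine (h1.integrable_mul h2).congr (Eventually.of_forall fun ω => ?_)
    simp only [Pi.mul_apply, Pi.add_apply, sampleLogTruncatedProb_swap]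
    rfl
  have hgI : Integrable g (μ.prod (μ.prod κ)) := by
    rw [← hlaw, integrable_map_measure hgm.aestronglyMeasurable hmt.aemeasurable]
    refine (hI1.add hI2).congr (Eventually.of_forall fun ω => ?_)
    simp only [Pi.add_apply, truncationGap_swap]
    rfl
  -- Moving the squared gaps to the left leaves a bound that is constant in the centres and can be
  -- integrated.
  have key := integral_prod_prod_le_of_forall_ne (C := 2 * (k - (harmonic (n + 1) : ℝ)) ^ 2)
    (hFI.sub hgI) fun x y hxy => by
      have hxT := h.memLp_logTruncatedProb (ι := Fin (n + 1)) hxy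
      have hyT := h.memLp_logTruncatedProb (ι := Fin (n + 1)) hxy.symm
      have hFz : Integrable (fun z => F (x, y, z)) κ :=
        ((memLp_const k).add hxT).integrable_mul ((memLp_const k).add hyT)
      have hgz : Integrable (fun z => g (x, y, z)) κ :=
        (hxT.sub (h.memLp_logNearestProb x)).integrable_sq.add
          (hyT.sub (h.memLp_logNearestProb y)).integrable_sq
      have h1 := h.integral_logTruncatedProb_mul_le (ι := Fin (n + 1)) hxy k
      rw [Fintype.card_fin] at h1
      simp only [Pi.sub_apply]
      rw [integral_sub hFz hgz]
      linarith
  simp only [Pi.sub_apply] at key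
  rw [integral_sub hFI hgI] at key
  rw [hFP, hgP]
  linarith

end IsIIDSequence

/-- The difference between the local entropy estimate at the `i`-th point of a sample and
`-log f` at this point. -/
def sampleError (f : E → ℝ) {N : ℕ} (x : Fin N → E) (i : Fin N) : ℝ :=
  Real.eulerMascheroniConstant + Real.log ((N : ℝ) - 1) +
    Real.log (volume.real (Metric.closedBall (x i) (minDist (x i) fun j : {j // j ≠ i} => x j))) +
    Real.log (f (x i))

lemma sampleError_comp_perm {N : ℕ} (x : Fin N → E) (σ : Equiv.Perm (Fin N)) (i : Fin N) :
    sampleError f (x ∘ σ) i = sampleError f x (σ i) := by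
  have : minDist ((x ∘ σ) i) (fun j : {j // j ≠ i} => (x ∘ σ) j) =
      minDist (x (σ i)) fun j : {j // j ≠ σ i} => x j :=
    Equiv.iInf_congr (σ.subtypeEquiv fun j => by simp) fun j => rfl
  rw [sampleError, sampleError, this]
  rfl

lemma forall_ne_zero_iff {n : ℕ} {p : Fin (n + 3) → Prop} :
    (∀ j : {j : Fin (n + 3) // j ≠ 0}, p j) ↔ (∀ j : Fin (n + 1), p j.succ.succ) ∧ p 1 := by
  rw [Subtype.forall, Fin.forall_fin_succ, Fin.forall_fin_succ]
  constructor
  · exact fun hp => ⟨fun j => hp.2.2 j (Fin.succ_ne_zero _), hp.2.1 (Fin.succ_ne_zero _)⟩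
  · exact fun hp => ⟨fun h => (h rfl).elim, fun _ => hp.2, fun j _ => hp.1 j⟩

lemma forall_ne_one_iff {n : ℕ} {p : Fin (n + 3) → Prop} :
    (∀ j : {j : Fin (n + 3) // j ≠ 1}, p j) ↔ (∀ j : Fin (n + 1), p j.succ.succ) ∧ p 0 := by
  rw [Subtype.forall, Fin.forall_fin_succ, Fin.forall_fin_succ]
  have h1 : ∀ j : Fin (n + 1), j.succ.succ ≠ (1 : Fin (n + 3)) := fun j hj =>
    Fin.succ_ne_zero j (Fin.succ_injective _ hj)
  constructor
  · exact fun hp => ⟨fun j => hp.2.2 j (h1 j), hp.1 zero_ne_one⟩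
  · exact fun hp => ⟨fun _ => hp.2, fun h => (h rfl).elim, fun j _ => hp.1 j⟩

lemma minDist_others_zero {n : ℕ} (x : Fin (n + 3) → E) :
    (minDist (x 0) fun j : {j : Fin (n + 3) // j ≠ 0} => x j) =
      min (minDist (x 0) fun j : Fin (n + 1) => x j.succ.succ) (dist (x 0) (x 1)) := by
  have : Nonempty {j : Fin (n + 3) // j ≠ 0} := ⟨⟨1, by simp⟩⟩
  refine eq_of_forall_lt_iff fun r => ?_
  rw [lt_min_iff, lt_minDist_iff, lt_minDist_iff]
  exact forall_ne_zero_iff (p := fun j => r < dist (x 0) (x j))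

lemma minDist_others_one {n : ℕ} (x : Fin (n + 3) → E) :
    (minDist (x 1) fun j : {j : Fin (n + 3) // j ≠ 1} => x j) =
      min (minDist (x 1) fun j : Fin (n + 1) => x j.succ.succ) (dist (x 1) (x 0)) := by
  have : Nonempty {j : Fin (n + 3) // j ≠ 1} := ⟨⟨0, by simp⟩⟩
  refine eq_of_forall_lt_iff fun r => ?_
  rw [lt_min_iff, lt_minDist_iff, lt_minDist_iff]
  exact forall_ne_one_iff (p := fun j => r < dist (x 1) (x j))

namespace IsIIDSequence

/-- The sample has n+3 points: two centres and n+1 others. The nearest neighbour distance of the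
first centre is the minimum over the tail and the second centre, which is the radius in
`truncationError`; the truncated log-probability is added and subtracted. -/
lemma sampleError_zero_eq (n : ℕ) (ω : Ω) :
    sampleError f (fun i : Fin (n + 3) => X i ω) 0 =
      (Real.eulerMascheroniConstant + Real.log ((n : ℝ) + 2) + sampleLogTruncatedProb μ X n ω) +
        sampleTruncationError μ f X n ω := by
  have hN : ((n + 3 : ℕ) : ℝ) - 1 = (n : ℝ) + 2 := by push_cast; ring
  have h0 := minDist_others_zero fun i : Fin (n + 3) => X i ω
  rw [sampleError, hN, sampleTruncationError,
    HasLogQuadraticDensity.truncationError, sampleLogTruncatedProb]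
  erw [h0]
  change _ + Real.log (volume.real (Metric.closedBall (X 0 ω)
    (min (minDist (X 0 ω) (tailPoints X n ω)) (dist (X 0 ω) (X 1 ω))))) + _ = _
  change _ + _ + Real.log (f (X 0 ω)) = _
  ring

lemma sampleError_one_eq (n : ℕ) (ω : Ω) :
    sampleError f (fun i : Fin (n + 3) => X i ω) 1 =
      (Real.eulerMascheroniConstant + Real.log ((n : ℝ) + 2) +
        sampleLogTruncatedProb μ (X ∘ Equiv.swap 0 1) n ω) +
        sampleTruncationError μ f (X ∘ Equiv.swap 0 1) n ω := by
  have hN : ((n + 3 : ℕ) : ℝ) - 1 = (n : ℝ) + 2 := by push_cast; ring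
  have h0 := minDist_others_one fun i : Fin (n + 3) => X i ω
  rw [sampleError, hN, sampleTruncationError, tailPoints_swap,
    HasLogQuadraticDensity.truncationError, sampleLogTruncatedProb_swap]
  simp only [Function.comp_apply, Equiv.swap_apply_left, Equiv.swap_apply_right]
  erw [h0]
  change _ + Real.log (volume.real (Metric.closedBall (X 1 ω)
    (min (minDist (X 1 ω) (tailPoints X n ω)) (dist (X 1 ω) (X 0 ω))))) + _ = _
  change _ + _ + Real.log (f (X 1 ω)) = _
  ring

/-- Split into c, the normalised untruncated logarithm and the gap. Its second moment bound 36,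
doubled twice, gives 144; log(n+2) is the right normalisation for n+1 tail points. -/
lemma integral_const_add_sampleLogTruncatedProb_sq_le (hX : IsIIDSequence P μ X)
    (h : HasLogQuadraticDensity μ f) (hμ : MemLp id 4 μ) (n : ℕ) (c : ℝ) :
    ∫ ω, (c + Real.log ((n : ℝ) + 2) + sampleLogTruncatedProb μ X n ω) ^ 2 ∂P ≤
      4 * c ^ 2 + 144 + 2 * ∫ ω, truncationGap μ X n ω ^ 2 ∂P := by
  have hS := hX.memLp_logNearestProb_tail h n
  have hS' := (memLp_const (μ := P) (Real.log ((n : ℝ) + 2))).add hS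
  have h1 := h.integral_log_card_add_logNearestProb_sq_le (hX.measurable 0)
    (hX.measurable_tailPoints n) (hX.map_head_tail_two (n + 1))
  have hN : ((Fintype.card (Fin (n + 1)) : ℕ) : ℝ) + 1 = (n : ℝ) + 2 := by
    rw [Fintype.card_fin]; push_cast; ring
  rw [hN] at h1
  have h2 := integral_add_sq_le (memLp_const (μ := P) c) hS'
  have h3 := integral_add_sq_le ((memLp_const (μ := P) c).add hS') (hX.memLp_truncationGap h hμ n)
  simp only [Pi.add_apply] at h2 h3
  rw [integral_const] at h2
  simp only [probReal_univ, one_smul] at h2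
  have h4 : ∀ ω, c + Real.log ((n : ℝ) + 2) + sampleLogTruncatedProb μ X n ω =
      c + (Real.log ((n : ℝ) + 2) + logNearestProb μ (X 0 ω) (tailPoints X n ω)) +
        truncationGap μ X n ω := by
    intro ω
    rw [sampleLogTruncatedProb, truncationGap]
    ring
  simp_rw [h4]
  linarith

/-- Each local error is a main term T plus a remainder R with E R² tending to 0. The product of the
main terms is handled by negative correlation, with γ + log(n+2) - `harmonic (n+1)` tending to 0;
the three products containing R are handled by Cauchy–Schwarz, since E T² is bounded. -/
lemma exists_sampleError_bounds (hX : IsIIDSequence P μ X) (h : HasLogQuadraticDensity μ f)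
    (hμ : MemLp id 4 μ) :
    ∃ a b : ℕ → ℝ, ∃ A : ℝ, Tendsto a atTop (𝓝 A) ∧ Tendsto b atTop (𝓝 0) ∧ (∀ n, 0 ≤ b n) ∧
      ∀ n, ∫ ω, sampleError f (fun i : Fin (n + 3) => X i ω) 0 ^ 2 ∂P ≤ a n ∧
        ∫ ω, sampleError f (fun i : Fin (n + 3) => X i ω) 0 *
          sampleError f (fun i : Fin (n + 3) => X i ω) 1 ∂P ≤ b n := by
  set c := Real.eulerMascheroniConstant
  set X' := X ∘ Equiv.swap 0 1 with hX'def
  have hX' : IsIIDSequence P μ X' := hX.swap_zero_one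
  set g : ℕ → ℝ := fun n => ∫ ω, truncationGap μ X n ω ^ 2 ∂P with hg
  set g' : ℕ → ℝ := fun n => ∫ ω, truncationGap μ X' n ω ^ 2 ∂P with hg'
  set r : ℕ → ℝ := fun n => ∫ ω, sampleTruncationError μ f X n ω ^ 2 ∂P with hr
  set r' : ℕ → ℝ := fun n => ∫ ω, sampleTruncationError μ f X' n ω ^ 2 ∂P with hr'
  have lg : Tendsto g atTop (𝓝 0) := hX.tendsto_integral_truncationGap_sq h hμ
  have lg' : Tendsto g' atTop (𝓝 0) := hX'.tendsto_integral_truncationGap_sq h hμ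
  have lr : Tendsto r atTop (𝓝 0) := hX.tendsto_integral_sampleTruncationError_sq h hμ
  have lr' : Tendsto r' atTop (𝓝 0) := hX'.tendsto_integral_sampleTruncationError_sq h hμ
  have hg0 : ∀ n, 0 ≤ g n := fun n => integral_nonneg fun ω => sq_nonneg _
  have hg'0 : ∀ n, 0 ≤ g' n := fun n => integral_nonneg fun ω => sq_nonneg _
  have le : Tendsto (fun n : ℕ => c + Real.log ((n : ℝ) + 2) - (harmonic (n + 1) : ℝ)) atTop
      (𝓝 0) := by
    have h1 := (((tendsto_add_atTop_iff_nat 1).2 Real.tendsto_eulerMascheroniSeq).const_sub c)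
    rw [sub_self] at h1
    refine h1.congr fun n => ?_
    rw [Real.eulerMascheroniSeq]
    push_cast
    rw [add_assoc (n : ℝ)]
    norm_num
    ring
  set t : ℕ → ℝ := fun n => 4 * c ^ 2 + 144 + 2 * g n with ht
  set t' : ℕ → ℝ := fun n => 4 * c ^ 2 + 144 + 2 * g' n with ht'
  have lt : Tendsto t atTop (𝓝 (4 * c ^ 2 + 144)) := by
    simpa using (lg.const_mul 2).const_add (4 * c ^ 2 + 144)
  have lt' : Tendsto t' atTop (𝓝 (4 * c ^ 2 + 144)) := by
    simpa using (lg'.const_mul 2).const_add (4 * c ^ 2 + 144)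
  refine ⟨fun n => 2 * t n + 2 * r n,
    fun n => 2 * (c + Real.log ((n : ℝ) + 2) - (harmonic (n + 1) : ℝ)) ^ 2 + (g n + g' n) +
      √(t n) * √(r' n) + √(r n) * √(t' n) + √(r n) * √(r' n), 2 * (4 * c ^ 2 + 144), ?_, ?_, ?_, ?_⟩
  · simpa using (lt.const_mul 2).add (lr.const_mul 2)
  · have h1 := ((((le.pow 2).const_mul 2).add (lg.add lg')).add (lt.sqrt.mul lr'.sqrt)).add
      (lr.sqrt.mul lt'.sqrt) |>.add (lr.sqrt.mul lr'.sqrt)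
    simpa using h1
  · intro n
    have := hg0 n
    have := hg'0 n
    positivity
  · intro n
    have hT := (memLp_const (μ := P) (c + Real.log ((n : ℝ) + 2))).add
      (hX.memLp_sampleLogTruncatedProb h hμ n)
    have hT' := (memLp_const (μ := P) (c + Real.log ((n : ℝ) + 2))).add
      (hX'.memLp_sampleLogTruncatedProb h hμ n)
    have hR := hX.memLp_sampleTruncationError h hμ n
    have hR' := hX'.memLp_sampleTruncationError h hμ n
    have bT := hX.integral_const_add_sampleLogTruncatedProb_sq_le h hμ n c
    have bT' := hX'.integral_const_add_sampleLogTruncatedProb_sq_le h hμ n c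
    constructor
    · simp_rw [sampleError_zero_eq (μ := μ)]
      have := integral_add_sq_le hT hR
      simp only [Pi.add_apply] at this
      simp only [ht, hr]
      linarith
    · simp_rw [sampleError_zero_eq (μ := μ), sampleError_one_eq (μ := μ)]
      have e1 := hX.integral_sampleLogTruncatedProb_mul_le h hμ n (c + Real.log ((n : ℝ) + 2))
      have e2 := integral_mul_le_sqrt_mul_sqrt hT hR'
      have e3 := integral_mul_le_sqrt_mul_sqrt hR hT'
      have e4 := integral_mul_le_sqrt_mul_sqrt hR hR'
      have s2 := Real.sqrt_le_sqrt bT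
      have s3 := Real.sqrt_le_sqrt bT'
      have i1 := hT.integrable_mul hT'
      have i2 := hT.integrable_mul hR'
      have i3 := hR.integrable_mul hT'
      have i4 := hR.integrable_mul hR'
      have hsplit : ∫ ω, ((c + Real.log ((n : ℝ) + 2) + sampleLogTruncatedProb μ X n ω) +
          sampleTruncationError μ f X n ω) *
          ((c + Real.log ((n : ℝ) + 2) + sampleLogTruncatedProb μ X' n ω) +
          sampleTruncationError μ f X' n ω) ∂P =
          ((∫ ω, (c + Real.log ((n : ℝ) + 2) + sampleLogTruncatedProb μ X n ω) *
            (c + Real.log ((n : ℝ) + 2) + sampleLogTruncatedProb μ X' n ω) ∂P +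
          ∫ ω, (c + Real.log ((n : ℝ) + 2) + sampleLogTruncatedProb μ X n ω) *
            sampleTruncationError μ f X' n ω ∂P) +
          ∫ ω, sampleTruncationError μ f X n ω *
            (c + Real.log ((n : ℝ) + 2) + sampleLogTruncatedProb μ X' n ω) ∂P) +
          ∫ ω, sampleTruncationError μ f X n ω * sampleTruncationError μ f X' n ω ∂P := by
        have j1 := integral_add ((i1.add i2).add i3) i4
        have j2 := integral_add (i1.add i2) i3
        have j3 := integral_add i1 i2
        simp only [Pi.add_apply, Pi.mul_apply] at j1 j2 j3
        rw [← j3, ← j2, ← j1]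
        congr 1
        funext ω
        ring
      rw [hsplit]
      simp only [Pi.add_apply] at e2 e3
      have f2 := e2.trans (mul_le_mul_of_nonneg_right s2 (Real.sqrt_nonneg _))
      have f3 := e3.trans (mul_le_mul_of_nonneg_left s3 (Real.sqrt_nonneg _))
      linarith

end IsIIDSequence

end Consistency

/-! ### Exchangeability, integrability and mean square limits of the averages. -/

section Consistency

variable {E : Type*} [NormedAddCommGroup E] [InnerProductSpace ℝ E] [FiniteDimensional ℝ E]
  [MeasurableSpace E] [BorelSpace E] [Nontrivial E] {μ : Measure E} [IsProbabilityMeasure μ]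
  {f : E → ℝ} {Ω : Type*} [MeasurableSpace Ω] {P : Measure Ω}
  [IsProbabilityMeasure P] {X : ℕ → Ω → E}

lemma nonempty_others {N : ℕ} (hN : 2 ≤ N) (i : Fin N) : Nonempty {j : Fin N // j ≠ i} := by
  have := Fin.nontrivial_iff_two_le.2 hN
  obtain ⟨j, hj⟩ := exists_ne i
  exact ⟨⟨j, hj⟩⟩

lemma exists_perm_apply {N : ℕ} {a b i j : Fin N} (hab : a ≠ b) (hij : i ≠ j) :
    ∃ σ : Equiv.Perm (Fin N), σ a = i ∧ σ b = j := by
  -- The first swap sends b to the preimage of j under the second one; it fixes a, because i ≠ j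
  -- makes that preimage different from a.
  refine ⟨(Equiv.swap b (Equiv.swap a i j)).trans (Equiv.swap a i), ?_, ?_⟩
  · rw [Equiv.trans_apply, Equiv.swap_apply_of_ne_of_ne hab, Equiv.swap_apply_left]
    intro h
    have := congrArg (Equiv.swap a i) h
    rw [Equiv.swap_apply_left, Equiv.swap_apply_self] at this
    exact hij this
  · simp

lemma measurable_sampleError (h : HasLogQuadraticDensity μ f) {N : ℕ} (i : Fin N) :
    Measurable fun x : Fin N → E => sampleError f x i := by
  have h2 : Measurable fun x : Fin N → E => minDist (x i) fun j : {j : Fin N // j ≠ i} => x j := by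
    unfold minDist
    exact Measurable.iInf fun j => by fun_prop
  have h3 := HasLogQuadraticDensity.measurable_log_volume_closedBall.comp
    ((measurable_pi_apply i : Measurable fun x : Fin N → E => x i).prodMk h2)
  have h4 := h.continuous_log.measurable.comp
    (measurable_pi_apply i : Measurable fun x : Fin N → E => x i)
  exact (h3.const_add _).add h4

namespace IsIIDSequence

lemma measurable_fin (hX : IsIIDSequence P μ X) (N : ℕ) :
    Measurable fun ω (i : Fin N) => X i ω :=
  measurable_pi_lambda _ fun _ => hX.measurable _

/-- The law of a finite sample is invariant under permutations. -/
lemma integral_comp_perm (hX : IsIIDSequence P μ X) {N : ℕ} (σ : Equiv.Perm (Fin N))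
    {φ : (Fin N → E) → ℝ} (hφ : Measurable φ) :
    ∫ ω, φ ((fun i : Fin N => X i ω) ∘ σ) ∂P = ∫ ω, φ (fun i : Fin N => X i ω) ∂P := by
  have hp := measurePreserving_arrowCongr' (fun _ : Fin N => μ) (fun _ : Fin N => μ) σ.symm
    (MeasurableEquiv.refl E) fun _ => MeasurePreserving.id μ
  have h1 : ∫ x : Fin N → E, φ (x ∘ σ) ∂Measure.pi (fun _ => μ) =
      ∫ x, φ x ∂Measure.pi fun _ => μ := hp.integral_comp' φ
  have hm := hX.measurable_fin N
  have hφσ : Measurable fun x : Fin N → E => φ (x ∘ σ) := hφ.comp (by fun_prop)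
  rw [← hX.map_fin N, integral_map hm.aemeasurable hφσ.aestronglyMeasurable,
    integral_map hm.aemeasurable hφ.aestronglyMeasurable] at h1
  exact h1

lemma ae_minDist_others_pos (hX : IsIIDSequence P μ X) (h : HasLogQuadraticDensity μ f) {N : ℕ}
    (hN : 2 ≤ N) : ∀ᵐ ω ∂P, ∀ i : Fin N,
      0 < minDist (X i ω) fun j : {j : Fin N // j ≠ i} => X j ω := by
  have h1 : ∀ᵐ ω ∂P, ∀ i j : Fin N, i ≠ j → X i ω ≠ X j ω := by
    rw [ae_all_iff]
    intro i
    rw [ae_all_iff]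
    intro j
    by_cases hij : i = j
    · simp [hij]
    · filter_upwards [hX.ae_ne h (fun hc => hij (Fin.ext hc))] with ω hω _ using hω
  filter_upwards [h1] with ω hω i
  have := nonempty_others hN i
  rw [lt_minDist_iff]
  exact fun j => dist_pos.2 (hω i j j.2.symm)

lemma measurable_minDist_others (hX : IsIIDSequence P μ X) {N : ℕ} (i : Fin N) :
    Measurable fun ω => minDist (X i ω) fun j : {j : Fin N // j ≠ i} => X j ω := by
  unfold minDist
  exact Measurable.iInf fun j => (hX.measurable _).dist (hX.measurable _)

/-- The minimum is attained, so its logarithm is one of the log-distances and is bounded by the sum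
of their absolute values. -/
lemma memLp_log_minDist_others (hX : IsIIDSequence P μ X) (h : HasLogQuadraticDensity μ f)
    (hμ : MemLp id 4 μ) {N : ℕ} (hN : 2 ≤ N) (i : Fin N) :
    MemLp (fun ω => Real.log (minDist (X i ω) fun j : {j : Fin N // j ≠ i} => X j ω)) 2 P := by
  have := nonempty_others hN i
  have hsum : MemLp (fun ω => ∑ j : {j : Fin N // j ≠ i}, ‖Real.log (dist (X i ω) (X j ω))‖) 2 P :=
    memLp_finsetSum _ fun j _ => (hX.memLp_log_dist h hμ fun hc => j.2 (Fin.ext hc.symm)).norm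
  refine hsum.mono (Real.measurable_log.comp (hX.measurable_minDist_others i)).aestronglyMeasurable
    (Eventually.of_forall fun ω => ?_)
  obtain ⟨j, hj⟩ := exists_dist_eq_minDist (X i ω) fun j : {j : Fin N // j ≠ i} => X j ω
  rw [← hj]
  refine le_trans ?_ (le_abs_self _)
  exact Finset.single_le_sum (f := fun j : {j : Fin N // j ≠ i} =>
    ‖Real.log (dist (X i ω) (X j ω))‖) (fun _ _ => norm_nonneg _) (Finset.mem_univ j)

lemma memLp_log_density (hX : IsIIDSequence P μ X) (h : HasLogQuadraticDensity μ f)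
    (hμ : MemLp id 4 μ) (i : ℕ) : MemLp (fun ω => Real.log (f (X i ω))) 2 P := by
  obtain ⟨K, hK⟩ := h.exists_abs_log_le
  have h1 : MemLp (fun _ : Ω => (1 : ℝ)) 2 P := memLp_const 1
  refine ((h1.add (hX.memLp_norm_sq hμ i)).const_mul K).mono
    (h.continuous_log.measurable.comp (hX.measurable i)).aestronglyMeasurable
    (Eventually.of_forall fun ω => ?_)
  exact (hK _).trans (le_abs_self _)

lemma memLp_mean_log_density (hX : IsIIDSequence P μ X) (h : HasLogQuadraticDensity μ f)
    (hμ : MemLp id 4 μ) (N : ℕ) :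
    MemLp (fun ω => (1 : ℝ) / N * ∑ i : Fin N, Real.log (f (X i ω))) 2 P := by
  have h1 : MemLp (fun ω => ∑ i : Fin N, Real.log (f (X i ω))) 2 P :=
    memLp_finsetSum _ fun (i : Fin N) _ => hX.memLp_log_density h hμ i
  exact h1.const_mul _

lemma memLp_sampleError (hX : IsIIDSequence P μ X) (h : HasLogQuadraticDensity μ f)
    (hμ : MemLp id 4 μ) {N : ℕ} (hN : 2 ≤ N) (i : Fin N) :
    MemLp (fun ω => sampleError f (fun i : Fin N => X i ω) i) 2 P := by
  have h1 := ((memLp_const (μ := P) (p := 2) (Real.eulerMascheroniConstant +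
    Real.log ((N : ℝ) - 1) + Real.log (volume.real (Metric.closedBall (0 : E) 1)))).add
    ((hX.memLp_log_minDist_others h hμ hN i).const_mul (Module.finrank ℝ E : ℝ))).add
    (hX.memLp_log_density h hμ i)
  refine h1.ae_eq ?_
  filter_upwards [hX.ae_minDist_others_pos h hN] with ω hω
  simp only [Pi.add_apply]
  rw [sampleError, log_volume_closedBall _ (hω i)]
  ring

lemma memLp_mean_sampleError (hX : IsIIDSequence P μ X) (h : HasLogQuadraticDensity μ f)
    (hμ : MemLp id 4 μ) {N : ℕ} (hN : 2 ≤ N) :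
    MemLp (fun ω => (1 : ℝ) / N * ∑ i, sampleError f (fun i : Fin N => X i ω) i) 2 P := by
  have h1 : MemLp (fun ω => ∑ i, sampleError f (fun i : Fin N => X i ω) i) 2 P :=
    memLp_finsetSum _ fun (i : Fin N) _ => hX.memLp_sampleError h hμ hN i
  exact h1.const_mul _

/-- The mean of the local errors tends to zero in mean square. -/
lemma tendsto_integral_mean_sampleError_sq (hX : IsIIDSequence P μ X)
    (h : HasLogQuadraticDensity μ f) (hμ : MemLp id 4 μ) :
    Tendsto (fun n : ℕ => ∫ ω, ((1 : ℝ) / (n + 3 : ℕ) *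
      ∑ i, sampleError f (fun i : Fin (n + 3) => X i ω) i) ^ 2 ∂P) atTop (𝓝 0) := by
  obtain ⟨a, b, A, ha, hb, hb0, hab⟩ := hX.exists_sampleError_bounds h hμ
  have hN : Tendsto (fun n : ℕ => ((n + 3 : ℕ) : ℝ)) atTop atTop :=
    tendsto_natCast_atTop_atTop.comp (tendsto_add_atTop_nat 3)
  have hlim : Tendsto (fun n => a n / ((n + 3 : ℕ) : ℝ) + b n) atTop (𝓝 0) := by
    simpa using (ha.div_atTop hN).add hb
  refine squeeze_zero (fun n => integral_nonneg fun ω => sq_nonneg _) (fun n => ?_) hlim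
  set ξ : Fin (n + 3) → Ω → ℝ := fun i ω => sampleError f (fun i : Fin (n + 3) => X i ω) i with hξ
  have hL : ∀ i, MemLp (ξ i) 2 P := fun i => hX.memLp_sampleError h hμ (by omega) i
  have hdiag : ∀ i, ∫ ω, ξ i ω * ξ i ω ∂P ≤ a n := by
    intro i
    have h1 := hX.integral_comp_perm (Equiv.swap 0 i)
      (φ := fun x : Fin (n + 3) → E => sampleError f x 0 ^ 2)
      ((measurable_sampleError h 0).pow_const 2)
    simp only [sampleError_comp_perm, Equiv.swap_apply_left] at h1
    simp only [hξ, ← pow_two]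
    exact h1.trans_le (hab n).1
  have hoff : ∀ i j, i ≠ j → ∫ ω, ξ i ω * ξ j ω ∂P ≤ b n := by
    intro i j hij
    obtain ⟨σ, rfl, rfl⟩ := exists_perm_apply (zero_ne_one : (0 : Fin (n + 3)) ≠ 1) hij
    have h1 := hX.integral_comp_perm σ
      (φ := fun x : Fin (n + 3) → E => sampleError f x 0 * sampleError f x 1)
      ((measurable_sampleError h 0).mul (measurable_sampleError h 1))
    simp only [sampleError_comp_perm] at h1
    exact h1.trans_le (hab n).2
  have ha0 : 0 ≤ a n := (integral_nonneg fun ω => sq_nonneg _).trans (hab n).1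
  have hexp : ∫ ω, ((1 : ℝ) / (n + 3 : ℕ) * ∑ i, ξ i ω) ^ 2 ∂P =
      ((1 : ℝ) / (n + 3 : ℕ)) ^ 2 * ∑ i, ∑ j, ∫ ω, ξ i ω * ξ j ω ∂P := by
    have hI : ∀ i j, Integrable (fun ω => ξ i ω * ξ j ω) P := fun i j =>
      (hL i).integrable_mul (hL j)
    simp_rw [mul_pow, pow_two (∑ i, ξ i _), Finset.sum_mul_sum]
    rw [integral_const_mul, integral_finsetSum _ fun i _ => integrable_finsetSum _ fun j _ => hI i j]
    simp_rw [integral_finsetSum _ fun j _ => hI _ j]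
  rw [hexp]
  have hrow : ∀ i, ∑ j, ∫ ω, ξ i ω * ξ j ω ∂P ≤ a n + (n + 3 : ℕ) * b n := by
    intro i
    rw [← Finset.add_sum_erase _ _ (Finset.mem_univ i)]
    refine add_le_add (hdiag i) ?_
    have h2 := Finset.sum_le_card_nsmul (Finset.univ.erase i) (fun j => ∫ ω, ξ i ω * ξ j ω ∂P) (b n)
      fun j hj => hoff i j (Finset.ne_of_mem_erase hj).symm
    refine h2.trans ?_
    rw [nsmul_eq_mul]
    -- Counting the n+2 off-diagonal terms as n+3 is harmless because b is nonnegative.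
    refine mul_le_mul_of_nonneg_right ?_ (hb0 n)
    exact_mod_cast (Finset.card_le_univ _).trans_eq (Fintype.card_fin _)
  have hsum : ∑ i, ∑ j, ∫ ω, ξ i ω * ξ j ω ∂P ≤
      (n + 3 : ℕ) * (a n + (n + 3 : ℕ) * b n) := by
    have := Finset.sum_le_card_nsmul Finset.univ (fun i => ∑ j, ∫ ω, ξ i ω * ξ j ω ∂P) _
      fun i _ => hrow i
    rwa [nsmul_eq_mul, Finset.card_univ, Fintype.card_fin] at this
  have hpos : (0 : ℝ) < ((n + 3 : ℕ) : ℝ) := by positivity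
  calc _ ≤ ((1 : ℝ) / (n + 3 : ℕ)) ^ 2 * ((n + 3 : ℕ) * (a n + (n + 3 : ℕ) * b n)) := by gcongr
    _ = _ := by field_simp

/-- The mean square form of the law of large numbers for `-log f`. -/
lemma tendsto_integral_mean_log_density_sq (hX : IsIIDSequence P μ X)
    (h : HasLogQuadraticDensity μ f) (hμ : MemLp id 4 μ) :
    Tendsto (fun n : ℕ => ∫ ω, ((1 : ℝ) / (n + 3 : ℕ) *
      ∑ i : Fin (n + 3), Real.log (f (X i ω)) - ∫ x, Real.log (f x) ∂μ) ^ 2 ∂P) atTop (𝓝 0) := by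
  set m := ∫ x, Real.log (f x) ∂μ with hm
  set V := variance (fun x => Real.log (f x)) μ with hV
  have hmeas := h.continuous_log.measurable
  have hmean : ∀ i, ∫ ω, Real.log (f (X i ω)) ∂P = m := fun i => by
    rw [hm, ← hX.map_eq i, integral_map (hX.measurable i).aemeasurable hmeas.aestronglyMeasurable]
  have hvar : ∀ i, variance (fun ω => Real.log (f (X i ω))) P = V := fun i => by
    rw [hV, ← hX.map_eq i, variance_map hmeas.aemeasurable (hX.measurable i).aemeasurable]
    rfl
  have hL := fun i => hX.memLp_log_density h hμ i
  have hN : Tendsto (fun n : ℕ => ((n + 3 : ℕ) : ℝ)) atTop atTop :=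
    tendsto_natCast_atTop_atTop.comp (tendsto_add_atTop_nat 3)
  refine (hN.const_div_atTop V).congr fun n => ?_
  have hpos : (0 : ℝ) < ((n + 3 : ℕ) : ℝ) := by positivity
  have hsum := IndepFun.variance_sum (μ := P) (s := Finset.univ)
    (X := fun (i : Fin (n + 3)) ω => Real.log (f (X i ω))) (fun i _ => hL i)
    fun i _ j _ hij => by
      have := hX.iIndepFun.indepFun (fun hc => hij (Fin.ext hc))
      exact this.comp hmeas hmeas
  simp only [hvar, Finset.sum_const, Finset.card_univ, Fintype.card_fin, nsmul_eq_mul] at hsum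
  have hLs : MemLp (fun ω => ∑ i : Fin (n + 3), Real.log (f (X i ω))) 2 P :=
    memLp_finsetSum _ fun i _ => hL i
  have hv2 : variance (fun ω => (1 : ℝ) / (n + 3 : ℕ) *
      ∑ i : Fin (n + 3), Real.log (f (X i ω))) P = V / (n + 3 : ℕ) := by
    rw [variance_const_mul]
    have : (fun ω => ∑ i : Fin (n + 3), Real.log (f (X i ω))) =
        ∑ i : Fin (n + 3), fun ω => Real.log (f (X i ω)) := by
      ext ω; simp
    rw [this, hsum]
    field_simp
  rw [← hv2, variance_eq_integral (hLs.const_mul _).aemeasurable]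
  have hE : ∫ ω, (1 : ℝ) / (n + 3 : ℕ) * ∑ i : Fin (n + 3), Real.log (f (X i ω)) ∂P = m := by
    rw [integral_const_mul, integral_finsetSum _ fun (i : Fin (n + 3)) _ => (hL i).integrable one_le_two]
    simp only [hmean, Finset.sum_const, Finset.card_univ, Fintype.card_fin, nsmul_eq_mul]
    field_simp
  rw [hE]

end IsIIDSequence

end Consistency

/-! ### The Kozachenko–Leonenko estimate in terms of local errors. -/

section KozachenkoLeonenko

variable {d : ℕ} {μ : Measure (EuclideanSpace ℝ (Fin d))} [IsProbabilityMeasure μ]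
  {f : EuclideanSpace ℝ (Fin d) → ℝ} {Ω : Type*} [MeasurableSpace Ω] {P : Measure Ω}
  [IsProbabilityMeasure P] {X : ℕ → Ω → EuclideanSpace ℝ (Fin d)}

lemma unitBallVolume_eq [Nonempty (Fin d)] :
    unitBallVolume d = volume.real (Metric.closedBall (0 : EuclideanSpace ℝ (Fin d)) 1) := by
  rw [measureReal_def, EuclideanSpace.volume_closedBall, unitBallVolume]
  simp only [ENNReal.ofReal_one, one_pow, one_mul, Fintype.card_fin]
  rw [ENNReal.toReal_ofReal (by positivity), Real.sqrt_eq_rpow, ← Real.rpow_natCast,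
    ← Real.rpow_mul Real.pi_pos.le]
  congr 2
  ring

/-- The logarithm of the geometric mean is the mean of the logarithms. Positivity of all the
distances is essential, since `Real.log 0 = 0`. -/
lemma kozachenkoLeonenko_eq {N : ℕ} (x : Fin N → EuclideanSpace ℝ (Fin d))
    (hx : ∀ i, 0 < minDist (x i) fun j : {j : Fin N // j ≠ i} => x j) :
    kozachenkoLeonenko x = (d : ℝ) * ((1 : ℝ) / N *
      ∑ i, Real.log (minDist (x i) fun j : {j : Fin N // j ≠ i} => x j)) +
      Real.log (unitBallVolume d) + Real.eulerMascheroniConstant + Real.log ((N : ℝ) - 1) := by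
  have hlog : Real.log (∏ i, nearestNeighborDist x i) = ∑ i, Real.log (nearestNeighborDist x i) :=
    Real.log_prod fun i _ => (hx i).ne'
  have hprod : 0 < ∏ i, nearestNeighborDist x i := Finset.prod_pos fun i _ => hx i
  rw [kozachenkoLeonenko, meanNearestNeighborDist, Real.log_rpow hprod, hlog]
  rfl

lemma kozachenkoLeonenko_eq_mean_sampleError [Nontrivial (EuclideanSpace ℝ (Fin d))]
    [Nonempty (Fin d)] {N : ℕ} (hN : 2 ≤ N) (x : Fin N → EuclideanSpace ℝ (Fin d))
    (hx : ∀ i, 0 < minDist (x i) fun j : {j : Fin N // j ≠ i} => x j) :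
    kozachenkoLeonenko x = (1 : ℝ) / N * ∑ i, sampleError f x i -
      (1 : ℝ) / N * ∑ i, Real.log (f (x i)) := by
  have hN0 : (N : ℝ) ≠ 0 := by positivity
  rw [kozachenkoLeonenko_eq x hx, ← mul_sub, ← Finset.sum_sub_distrib]
  have h1 : ∀ i, sampleError f x i - Real.log (f (x i)) = (d : ℝ) *
      Real.log (minDist (x i) fun j : {j : Fin N // j ≠ i} => x j) +
      (Real.log (unitBallVolume d) + Real.eulerMascheroniConstant + Real.log ((N : ℝ) - 1)) := by
    intro i
    rw [sampleError, log_volume_closedBall _ (hx i), finrank_euclideanSpace_fin, unitBallVolume_eq]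
    ring
  simp_rw [h1, Finset.sum_add_distrib, ← Finset.mul_sum]
  simp only [Finset.sum_const, Finset.card_univ, Fintype.card_fin, nsmul_eq_mul]
  field_simp
  ring

namespace IsIIDSequence

variable [Nontrivial (EuclideanSpace ℝ (Fin d))] [Nonempty (Fin d)]

lemma memLp_kozachenkoLeonenko (hX : IsIIDSequence P μ X) (h : HasLogQuadraticDensity μ f)
    (hμ : MemLp id 4 μ) {N : ℕ} (hN : 2 ≤ N) :
    MemLp (fun ω => kozachenkoLeonenko fun i : Fin N => X i ω) 2 P := by
  refine ((hX.memLp_mean_sampleError h hμ hN).sub (hX.memLp_mean_log_density h hμ N)).ae_eq ?_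
  filter_upwards [hX.ae_minDist_others_pos h hN] with ω hω
  exact (kozachenkoLeonenko_eq_mean_sampleError hN _ hω).symm

lemma tendsto_integral_kozachenkoLeonenko_sub_sq (hX : IsIIDSequence P μ X)
    (h : HasLogQuadraticDensity μ f) (hμ : MemLp id 4 μ) :
    Tendsto (fun N : ℕ => ∫ ω, (kozachenkoLeonenko (fun i : Fin N => X i ω) -
      -∫ x, Real.log (f x) ∂μ) ^ 2 ∂P) atTop (𝓝 0) := by
  -- The moment bounds concern samples of size n+3, so that a tail point remains besides the two
  -- centres.
  rw [← tendsto_add_atTop_iff_nat 3]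
  have hlim := ((hX.tendsto_integral_mean_sampleError_sq h hμ).const_mul 2).add
    ((hX.tendsto_integral_mean_log_density_sq h hμ).const_mul 2)
  simp only [mul_zero, add_zero] at hlim
  refine squeeze_zero (fun n => integral_nonneg fun ω => sq_nonneg _) (fun n => ?_) hlim
  set m := ∫ x, Real.log (f x) ∂μ
  have h1 := hX.memLp_mean_sampleError h hμ (by omega : 2 ≤ n + 3)
  have hm : MemLp (fun _ : Ω => m) 2 P := memLp_const m
  have h2 := ((hX.memLp_mean_log_density h hμ (n + 3)).sub hm).neg
  have h3 := integral_add_sq_le h1 h2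
  simp only [Pi.neg_apply, Pi.sub_apply, neg_sq] at h3
  refine le_trans (le_of_eq (integral_congr_ae ?_)) h3
  filter_upwards [hX.ae_minDist_others_pos h (by omega : 2 ≤ n + 3)] with ω hω
  rw [kozachenkoLeonenko_eq_mean_sampleError (f := f) (by omega) _ hω]
  ring

/-- The bias is at most the root mean square error. The estimate is known to be integrable only from
N = 2 on, hence the eventual bound. -/
lemma tendsto_integral_kozachenkoLeonenko (hX : IsIIDSequence P μ X)
    (h : HasLogQuadraticDensity μ f) (hμ : MemLp id 4 μ) :
    Tendsto (fun N : ℕ => ∫ ω, kozachenkoLeonenko (fun i : Fin N => X i ω) ∂P) atTop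
      (𝓝 (-∫ x, Real.log (f x) ∂μ)) := by
  set m := ∫ x, Real.log (f x) ∂μ
  have hsq := hX.tendsto_integral_kozachenkoLeonenko_sub_sq h hμ
  have hsqrt := hsq.sqrt
  rw [Real.sqrt_zero] at hsqrt
  rw [tendsto_iff_dist_tendsto_zero]
  refine squeeze_zero' (Eventually.of_forall fun _ => dist_nonneg) ?_ hsqrt
  filter_upwards [eventually_ge_atTop 2] with N hN
  have hL := hX.memLp_kozachenkoLeonenko h hμ hN
  have h1 := sq_integral_le_integral_sq (hL.sub (memLp_const (-m)))
  simp only [Pi.sub_apply] at h1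
  rw [integral_sub (hL.integrable one_le_two) (integrable_const _), integral_const] at h1
  simp only [probReal_univ, one_smul] at h1
  rw [Real.dist_eq]
  exact Real.abs_le_sqrt h1

end IsIIDSequence

end KozachenkoLeonenko

end

theorem corollary4 {d : ℕ} (hd : 1 ≤ d)
    (ν : EuclideanSpace ℝ (Fin d)) (S : Matrix (Fin d) (Fin d) ℝ) (hS : S.PosDef)
    {Ω : Type*} [MeasurableSpace Ω] (P : Measure Ω) [IsProbabilityMeasure P]
    (X : ℕ → Ω → EuclideanSpace ℝ (Fin d))
    (hlaw : ∀ i, HasLaw (X i) (multivariateGaussian ν S) P)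
    (hindep : iIndepFun X P)
    (H : ℝ) (hH : H = 1 / 2 * Real.log (((2 * Real.pi * Real.exp 1) • S).det)) :
    -- the Gaussian law has a density `f`, and `H` is the entropy `-∫ f log f`
    (multivariateGaussian ν S ≪ (volume : Measure (EuclideanSpace ℝ (Fin d))) ∧
      Integrable (fun x => lebesgueDensity (multivariateGaussian ν S) x *
        Real.log (lebesgueDensity (multivariateGaussian ν S) x)) ∧
      shannonEntropy (lebesgueDensity (multivariateGaussian ν S)) = H) ∧
    -- the estimates are square integrable
    (∀ N : ℕ, 2 ≤ N →
      MemLp (fun ω => kozachenkoLeonenko (fun i : Fin N => X i ω)) 2 P) ∧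
    -- asymptotic unbiasedness
    Tendsto (fun N : ℕ => ∫ ω, kozachenkoLeonenko (fun i : Fin N => X i ω) ∂P)
      atTop (𝓝 H) ∧
    -- consistency in mean square
    Tendsto (fun N : ℕ => ∫ ω, (kozachenkoLeonenko (fun i : Fin N => X i ω) - H) ^ 2 ∂P)
      atTop (𝓝 0) := by
  have : Nonempty (Fin d) := ⟨⟨0, hd⟩⟩
  have : Nontrivial (EuclideanSpace ℝ (Fin d)) := by
    refine Module.nontrivial_of_finrank_pos (R := ℝ) ?_
    rw [finrank_euclideanSpace_fin]
    exact hd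
  have hf : HasLogQuadraticDensity (multivariateGaussian ν S) (gaussianDensity ν S) :=
    ⟨multivariateGaussian_eq_withDensity hS, continuous_gaussianDensity, gaussianDensity_pos hS,
      abs_log_gaussianDensity_le hS⟩
  -- The fourth moment makes the squared norms in the error bounds square integrable.
  have hμ : MemLp id 4 (multivariateGaussian ν S) :=
    IsGaussian.memLp_id _ 4 (by norm_num)
  have hHm : -∫ x, Real.log (gaussianDensity ν S x) ∂(multivariateGaussian ν S) = H := by
    rw [integral_log_gaussianDensity hS, neg_neg, hH]
  have hae : ∀ᵐ ω ∂P, ∀ i, X i ω = (hlaw i).aemeasurable.mk (X i) ω :=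
    ae_all_iff.2 fun i => (hlaw i).aemeasurable.ae_eq_mk
  -- `HasLaw` gives only almost everywhere measurability; measurable versions have the same laws and
  -- independence and change the estimates only on a null set.
  set Y : ℕ → Ω → EuclideanSpace ℝ (Fin d) := fun i => (hlaw i).aemeasurable.mk (X i) with hYdef
  have hY : IsIIDSequence P (multivariateGaussian ν S) Y :=
    ⟨fun i => (hlaw i).aemeasurable.measurable_mk,
      fun i => by rw [← (hlaw i).map_eq]; exact (Measure.map_congr (hlaw i).aemeasurable.ae_eq_mk).symm,
      (iIndepFun_congr fun i => (hlaw i).aemeasurable.ae_eq_mk).1 hindep⟩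
  have hXY : ∀ N : ℕ, (fun ω => kozachenkoLeonenko fun i : Fin N => X i ω) =ᵐ[P]
      fun ω => kozachenkoLeonenko fun i : Fin N => Y i ω := by
    intro N
    filter_upwards [hae] with ω hω
    simp only [hω, hYdef]
  refine ⟨hH ▸ gaussian_entropy hS, fun N hN => ?_, ?_, ?_⟩
  · exact (hY.memLp_kozachenkoLeonenko hf hμ hN).ae_eq (hXY N).symm
  · rw [← hHm]
    exact (hY.tendsto_integral_kozachenkoLeonenko hf hμ).congr fun N =>
      (integral_congr_ae (hXY N)).symm
  · rw [← hHm]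
    refine (hY.tendsto_integral_kozachenkoLeonenko_sub_sq hf hμ).congr fun N =>
      integral_congr_ae ?_
    filter_upwards [hXY N] with ω hω
    rw [hω]
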